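/- Let $n\ge1$, let $\mathbb B^n$ be the open unit ball of $\mathbb C^n$, and let $d\sigma$ be the normalized surface measure on $\partial\mathbb B^n$, with $\|u\|_{\partial\mathbb B^n}$ the norm of $u$ in $L^2(\partial\mathbb B^n,d\sigma)$. For $s>-1$ let $\|\cdot\|_s$ be the norm in $L^2(\mathbb B^n,d\mu_s)$, where $$d\mu_s(z)=\frac{\Gamma(s+n+1)}{\pi^n\,\Gamma(s+1)}(1-|z|^2)^s\,dz .$$ A function $f:\mathbb B^n\to\mathbb C$ is pluriharmonic if it is $C^2$ and $\partial^2 f/\partial z_j\partial\bar z_k=0$ for all $j,k$. Such an $f$ has a unique decomposition $f=\sum_{p\ge0}f_{p0}+\sum_{q\ge1}f_{0q}$, converging locally uniformly on $\mathbb B^n$, where $f_{p0}$ is a homogeneous polynomial of degree $p$ in $z$ and $f_{0q}$ is a homogeneous polynomial of degree $q$ in $\bar z$. Put $$\|f\|_\circ^2:=\sum_{p=1}^\infty p\,\frac{(n)_p}{p!}\bigl(\|f_{p0}\|^2_{\partial\mathbb B^n}+\|f_{0p}\|^2_{\partial\mathbb B^n}\bigr)\in[0,\infty],\qquad (n)_p=n(n+1)\cdots(n+p-1),$$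 and let the pluriharmonic Dirichlet space $\mathcal M_\circ$ consist of all pluriharmonic $f$ on $\mathbb B^n$ with $\|f\|_\circ<\infty$. Let $\mathcal N:=\sum_{j=1}^n\bigl(z_j\frac{\partial}{\partial z_j}+\bar z_j\frac{\partial}{\partial\bar z_j}\bigr)$ be the radial derivative. Theorem. For a pluriharmonic function $f$ on $\mathbb B^n$ the following are equivalent: (i) $f\in\mathcal M_\circ$; (ii) $\|\mathcal N^m f\|^2_{2m-n-1}<\infty$ for some integer $m>n/2$; (iii) $\|\mathcal N^m f\|^2_{2m-n-1}<\infty$ for every integer $m>n/2$. Furthermore, $\mathcal M_\circ$ is a complex vector space, $\|\cdot\|_\circ$ is a seminorm on it, and for every integer $m>n/2$ the functional $f\mapsto\|\mathcal N^m f\|_{2m-n-1}$ is a seminorm on $\mathcal M_\circ$ equivalent to $\|\cdot\|_\circ$: there are constants $0<c\le C<\infty$, depending only on $n$ and $m$, such that $c\,\|f\|_\circ\le\|\mathcal N^m f\|_{2m-n-1}\le C\,\|f\|_\circ$ for all $f\in\mathcal M_\circ$. -/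

import Mathlib

open MeasureTheory Filter Topology
open scoped ENNReal ComplexConjugate Nat

noncomputable section

/-- Complex `n`-space `ℂⁿ` with its Euclidean norm. -/
abbrev Cn (n : ℕ) : Type := EuclideanSpace ℂ (Fin n)

/-- The open unit ball of `ℂⁿ`. -/
abbrev unitBall (n : ℕ) : Set (Cn n) := Metric.ball 0 1

/-- The standard basis vector `e_j` of `ℂⁿ`. -/
def stdVec (n : ℕ) (j : Fin n) : Cn n := EuclideanSpace.single j (1 : ℂ)

/-- The Wirtinger derivative `∂f/∂z_j = (∂f/∂x_j - i ∂f/∂y_j) / 2`. -/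
def wirtinger (n : ℕ) (j : Fin n) (f : Cn n → ℂ) (z : Cn n) : ℂ :=
  (fderiv ℝ f z (stdVec n j) - Complex.I * fderiv ℝ f z (Complex.I • stdVec n j)) / 2

/-- The Wirtinger derivative `∂f/∂z̄_j = (∂f/∂x_j + i ∂f/∂y_j) / 2`. -/
def wirtingerBar (n : ℕ) (j : Fin n) (f : Cn n → ℂ) (z : Cn n) : ℂ :=
  (fderiv ℝ f z (stdVec n j) + Complex.I * fderiv ℝ f z (Complex.I • stdVec n j)) / 2

/-- `f` is pluriharmonic on the unit ball: it is of class `C²` there and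
`∂²f/∂z_j∂z̄_k = 0` for all `j, k`. Only the values of `f` on the ball matter. -/
def IsPluriharmonic (n : ℕ) (f : Cn n → ℂ) : Prop :=
  ContDiffOn ℝ 2 f (unitBall n) ∧
    ∀ z ∈ unitBall n, ∀ j k : Fin n, wirtinger n j (wirtingerBar n k f) z = 0

/-- The radial derivative `𝒩 f = ∑_j z_j ∂f/∂z_j + z̄_j ∂f/∂z̄_j`. -/
def radialDeriv (n : ℕ) (f : Cn n → ℂ) (z : Cn n) : ℂ :=
  ∑ j : Fin n, (z j * wirtinger n j f z + conj (z j) * wirtingerBar n j f z)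

/-- The measure `dμ_s(z) = Γ(s+n+1) / (π^n Γ(s+1)) (1-|z|²)^s dz` on the unit ball. -/
def bergmanMeasure (n : ℕ) (s : ℝ) : Measure (Cn n) :=
  (volume.restrict (unitBall n)).withDensity fun z =>
    ENNReal.ofReal (Real.Gamma (s + n + 1) / (Real.pi ^ n * Real.Gamma (s + 1)) *
      (1 - ‖z‖ ^ 2) ^ s)

/-- The squared norm `‖g‖²_s` of `L²(𝔹ⁿ, dμ_s)`, with value `∞` allowed. -/
def bergmanNormSq (n : ℕ) (s : ℝ) (g : Cn n → ℂ) : ℝ≥0∞ :=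
  ∫⁻ z, ‖g z‖ₑ ^ 2 ∂(bergmanMeasure n s)

/-- The normalized surface measure `dσ` on the unit sphere of `ℂⁿ`. -/
def sphereMeasure (n : ℕ) : Measure (Metric.sphere (0 : Cn n) 1) :=
  ((volume : Measure (Cn n)).toSphere Set.univ)⁻¹ • (volume : Measure (Cn n)).toSphere

/-- The squared norm of the restriction of `u` to the sphere in `L²(∂𝔹ⁿ, dσ)`. -/
def sphereNormSq (n : ℕ) (u : Cn n → ℂ) : ℝ≥0∞ :=
  ∫⁻ ζ : Metric.sphere (0 : Cn n) 1, ‖u ζ‖ₑ ^ 2 ∂(sphereMeasure n)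

/-- The solid harmonics of bidegree `(p, 0)`: polynomials in `z` homogeneous of degree `p`
(these are automatically harmonic, and Moebius-harmonic). -/
def solidHol (n p : ℕ) : Set (Cn n → ℂ) :=
  {u | ∃ P : MvPolynomial (Fin n) ℂ, P.IsHomogeneous p ∧
    ∀ z, u z = MvPolynomial.eval (fun j => z j) P}

/-- The solid harmonics of bidegree `(0, q)`: polynomials in `z̄` homogeneous of degree `q`. -/
def solidAnti (n q : ℕ) : Set (Cn n → ℂ) :=
  {v | ∃ P : MvPolynomial (Fin n) ℂ, P.IsHomogeneous q ∧
    ∀ z, v z = MvPolynomial.eval (fun j => conj (z j)) P}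

/-- `(u, v)` is the Peter-Weyl decomposition of the pluriharmonic function `f`:
`f = ∑_{p ≥ 0} u_p + ∑_{q ≥ 1} v_q` locally uniformly on the unit ball, with
`u_p = f_{p0}` of bidegree `(p, 0)` and `v_q = f_{0q}` of bidegree `(0, q)`.
The constant term is counted once, as `u_0`. -/
structure IsPeterWeyl (n : ℕ) (f : Cn n → ℂ) (u v : ℕ → Cn n → ℂ) : Prop where
  hol : ∀ p, u p ∈ solidHol n p
  anti : ∀ q, v q ∈ solidAnti n q
  anti_zero : v 0 = 0
  tendsto : TendstoLocallyUniformlyOn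
    (fun (N : ℕ) (z : Cn n) => ∑ p ∈ Finset.range N, (u p z + v p z)) f atTop (unitBall n)

/-- The squared seminorm
`‖f‖²_∘ = ∑_p p (n)_p / p! (‖f_{p0}‖²_{∂𝔹ⁿ} + ‖f_{0p}‖²_{∂𝔹ⁿ})`, with value `∞` allowed, where
`(n)_p = n (n+1) ⋯ (n+p-1)`. The Peter-Weyl decomposition of a function is unique when it
exists, so the infimum is just the value at that decomposition, and is `∞` if there is none. -/
def dirichletNormSq (n : ℕ) (f : Cn n → ℂ) : ℝ≥0∞ :=
  ⨅ (u : ℕ → Cn n → ℂ) (v : ℕ → Cn n → ℂ) (_ : IsPeterWeyl n f u v),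
    ∑' p : ℕ, ENNReal.ofReal ((p : ℝ) * (n.ascFactorial p : ℝ) / (p ! : ℝ)) *
      (sphereNormSq n (u p) + sphereNormSq n (v p))

/-- The pluriharmonic Dirichlet space `ℳ_∘`. -/
def dirichletSpace (n : ℕ) : Set (Cn n → ℂ) :=
  {f | IsPluriharmonic n f ∧ dirichletNormSq n f < ⊤}

/-- The quantity `‖𝒩^m f‖²_{2m-n-1}`. -/
def radialEnergy (n m : ℕ) (f : Cn n → ℂ) : ℝ≥0∞ :=
  bergmanNormSq n (2 * (m : ℝ) - n - 1) ((radialDeriv n)^[m] f)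

end

/-!
Poincaré's lemma writes a pluriharmonic `f` as `h + conj k` with `h` and `k` holomorphic, so that
its Peter–Weyl components are the Taylor components of `h` and the conjugates of those of `k`. The
measure `μ_s` is invariant under the rotations `z ↦ e^{2πit} z`. Averaging over `t` and applying
Parseval's identity on each circle makes the components orthogonal, and polar coordinates express
`‖f‖_s²` as a sum of radial moments of `μ_s` times the squares of the norms of the components on
the sphere. Since `𝒩` multiplies the components of degree `p` by `p`, for `s = 2m - n - 1` the
beta integral turns the weight of degree `p` into `p ^ (2m) Γ(n + p) Γ(2m) / (Γ(n) Γ(p + 2m))`,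
which is comparable to `p (n)_p / p!` uniformly in `p`.
-/

section Holomorphic

variable {E F ι : Type*} [NormedAddCommGroup E] [NormedSpace ℂ E] [NormedAddCommGroup F]
  [NormedSpace ℂ F] {U : Set E} {h : E → F}

lemma norm_fderiv_le_of_forall_mem_ball_norm_le {c : E} {R M : ℝ} (hR : 0 < R)
    (hd : DifferentiableOn ℂ h (Metric.ball c R)) (hM : ∀ z ∈ Metric.ball c R, ‖h z‖ ≤ M) :
    ‖fderiv ℂ h c‖ ≤ 2 * M / R :=
  Complex.norm_fderiv_le_div_of_mapsTo_ball hd (fun z hz => mem_closedBall_iff_norm.2 <|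
    (norm_sub_le _ _).trans (by linarith [hM z hz, hM c (Metric.mem_ball_self hR)])) hR

lemma norm_sub_sub_fderiv_le_of_forall_mem_ball_norm_le {c z : E} {R M : ℝ}
    (hd : DifferentiableOn ℂ h (Metric.ball c R)) (hM : ∀ z ∈ Metric.ball c R, ‖h z‖ ≤ M)
    (hz : z ∈ Metric.ball c R) :
    ‖h z - h c - fderiv ℂ h c (z - c)‖ ≤ 4 * M * (‖z - c‖ / R) ^ 2 := by
  have hR : 0 < R := Metric.pos_of_mem_ball hz
  have hc : HasFDerivAt h (fderiv ℂ h c) c :=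
    (hd.differentiableAt (Metric.ball_mem_nhds c hR)).hasFDerivAt
  set remainder : E → F := fun w => h w - fderiv ℂ h c (w - c)
  have hmaps : Set.MapsTo remainder (Metric.ball c R)
      (Metric.closedBall (remainder c) (4 * M)) := by
    intro w hw
    have hlin : ‖fderiv ℂ h c (w - c)‖ ≤ 2 * M := calc
      _ ≤ 2 * M / R * R := (fderiv ℂ h c).le_of_opNorm_le_of_le
        (norm_fderiv_le_of_forall_mem_ball_norm_le hR hd hM) (mem_ball_iff_norm.1 hw).le
      _ = 2 * M := by field_simp
    have hdiff : ‖h w - h c‖ ≤ 2 * M :=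
      (norm_sub_le _ _).trans (by linarith [hM w hw, hM c (Metric.mem_ball_self hR)])
    rw [mem_closedBall_iff_norm]
    calc ‖remainder w - remainder c‖ = ‖(h w - h c) - fderiv ℂ h c (w - c)‖ := by
          simp [remainder, sub_right_comm]
      _ ≤ 4 * M := (norm_sub_le _ _).trans (by linarith)
  have := Complex.dist_le_mul_div_pow_of_mapsTo_ball_of_isLittleO (n := 1) (f := remainder)
    (hd.sub (by fun_prop)) hmaps
    (by simpa [remainder, sub_right_comm] using hc.isLittleO.norm_right) hz
  simpa [remainder, dist_eq_norm, sub_right_comm] using this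

lemma uniformCauchySeqOn_fderiv {f : ι → E → F} {l : Filter ι} {c : E} {R : ℝ} (hR : 0 < R)
    (hf : UniformCauchySeqOn f l (Metric.ball c (2 * R)))
    (hd : ∀ᶠ i in l, DifferentiableOn ℂ (f i) (Metric.ball c (2 * R))) :
    UniformCauchySeqOn (fun i => fderiv ℂ (f i)) l (Metric.ball c R) := by
  intro u hu
  obtain ⟨ε, hε, hεu⟩ := Metric.mem_uniformity_dist.1 hu
  filter_upwards [hf _ (Metric.dist_mem_uniformity (show 0 < ε * R / 4 by positivity)),
    hd.prod_mk hd] with ⟨i, j⟩ hij ⟨hdi, hdj⟩ z hz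
  have hsub : Metric.ball z R ⊆ Metric.ball c (2 * R) :=
    Metric.ball_subset_ball' (by linarith [Metric.mem_ball.1 hz])
  have hz' : Metric.ball c (2 * R) ∈ 𝓝 z :=
    Metric.isOpen_ball.mem_nhds (hsub (Metric.mem_ball_self hR))
  apply hεu
  rw [dist_eq_norm, ← fderiv_sub (hdi.differentiableAt hz') (hdj.differentiableAt hz')]
  calc ‖fderiv ℂ (f i - f j) z‖ ≤ 2 * (ε * R / 4) / R :=
        norm_fderiv_le_of_forall_mem_ball_norm_le hR ((hdi.sub hdj).mono hsub)
          fun w hw => (dist_eq_norm (f i w) _).symm.trans_le (hij w (hsub hw)).le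
    _ = ε / 2 := by field_simp; norm_num
    _ < ε := half_lt_self hε

lemma tendstoUniformlyOn_inv_smul_sub {V : E → E} {s : Set E} {R M L : ℝ} (hR : 0 < R)
    (hd : ∀ z ∈ s, DifferentiableOn ℂ h (Metric.ball z R))
    (hM : ∀ z ∈ s, ∀ w ∈ Metric.ball z R, ‖h w‖ ≤ M) (hL : ∀ z ∈ s, ‖V z‖ ≤ L) :
    TendstoUniformlyOn (fun (t : ℂ) z => t⁻¹ • (h (z + t • V z) - h z))
      (fun z => fderiv ℂ h z (V z)) (𝓝[≠] 0) s := by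
  rw [Metric.tendstoUniformlyOn_iff]
  intro ε hε
  have hsmall : ∀ᶠ t : ℂ in 𝓝 0, ‖t‖ * L < R :=
    (by fun_prop : Continuous fun t : ℂ => ‖t‖ * L).continuousAt.eventually_lt_const (by simpa)
  have herror : ∀ᶠ t : ℂ in 𝓝 0, 4 * M * (L / R) ^ 2 * ‖t‖ < ε :=
    (by fun_prop : Continuous fun t : ℂ => 4 * M * (L / R) ^ 2 * ‖t‖).continuousAt
      |>.eventually_lt_const (by simpa)
  filter_upwards [nhdsWithin_le_nhds hsmall, nhdsWithin_le_nhds herror, self_mem_nhdsWithin]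
    with t htR htε (ht : t ≠ 0) z hz
  have hM0 : 0 ≤ M := (norm_nonneg _).trans (hM z hz z (Metric.mem_ball_self hR))
  have hV : ‖t • V z‖ ≤ ‖t‖ * L := by
    rw [norm_smul]
    gcongr
    exact hL z hz
  have hmem : z + t • V z ∈ Metric.ball z R := by simpa using hV.trans_lt htR
  have htaylor := norm_sub_sub_fderiv_le_of_forall_mem_ball_norm_le (hd z hz) (hM z hz) hmem
  rw [add_sub_cancel_left] at htaylor
  rw [dist_comm, dist_eq_norm]
  calc ‖t⁻¹ • (h (z + t • V z) - h z) - fderiv ℂ h z (V z)‖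
      = ‖t‖⁻¹ * ‖h (z + t • V z) - h z - fderiv ℂ h z (t • V z)‖ := by
        rw [← norm_inv, ← norm_smul, map_smul, smul_sub t⁻¹ (_ - _) (t • _),
          inv_smul_smul₀ ht]
    _ ≤ ‖t‖⁻¹ * (4 * M * (‖t‖ * L / R) ^ 2) := by grw [htaylor, hV]
    _ = 4 * M * (L / R) ^ 2 * ‖t‖ := by
        have := norm_ne_zero_iff.2 ht
        field_simp
    _ < ε := htε

variable [CompleteSpace F]

theorem differentiableOn_of_tendstoUniformlyOn {f : ι → E → F} {l : Filter ι} [NeBot l]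
    (hU : IsOpen U) (hf : TendstoUniformlyOn f h l U)
    (hd : ∀ᶠ i in l, DifferentiableOn ℂ (f i) U) : DifferentiableOn ℂ h U := by
  intro c hc
  obtain ⟨R, hR, hRU⟩ : ∃ R > 0, Metric.ball c (2 * R) ⊆ U := by
    obtain ⟨R, hR, hRU⟩ := Metric.isOpen_iff.1 hU c hc
    exact ⟨R / 2, by positivity, by rwa [mul_div_cancel₀ R two_ne_zero]⟩
  have hcauchy : UniformCauchySeqOn (fun i => fderiv ℂ (f i)) l (Metric.ball c R) :=
    uniformCauchySeqOn_fderiv hR (hf.mono hRU).uniformCauchySeqOn (hd.mono fun i hi => hi.mono hRU)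
  choose! h' hh' using fun z (hz : z ∈ Metric.ball c R) =>
    CompleteSpace.complete (hcauchy.cauchy_map hz)
  have hball : Metric.ball c R ∈ 𝓝 c := Metric.ball_mem_nhds c hR
  have hsub : Metric.ball c R ⊆ U := (Metric.ball_subset_ball (by linarith)).trans hRU
  refine (hasFDerivAt_of_tendstoUniformlyOnFilter (f := f) (g' := h')
    (f' := fun i => fderiv ℂ (f i)) (l := l) ?_ ?_
    ?_).differentiableAt.differentiableWithinAt
  · exact ((hcauchy.tendstoUniformlyOn_of_tendsto hh').tendstoUniformlyOnFilter).mono_right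
      (le_principal_iff.2 hball)
  · filter_upwards [hd.prod_mk hball] with ⟨i, z⟩ ⟨hi, hz⟩
    exact (hi.differentiableAt (hU.mem_nhds (hsub hz))).hasFDerivAt
  · filter_upwards [hball] with z hz using hf.tendsto_at (hsub hz)

theorem differentiableOn_fderiv_apply (hU : IsOpen U) (hh : DifferentiableOn ℂ h U)
    {V : E → E} (hV : DifferentiableOn ℂ V U) :
    DifferentiableOn ℂ (fun z => fderiv ℂ h z (V z)) U := by
  intro c hc
  obtain ⟨M, hM⟩ : ∃ M, ∀ᶠ z in 𝓝 c, ‖h z‖ ≤ M :=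
    ⟨_, (hh.differentiableAt (hU.mem_nhds hc)).continuousAt.norm.eventually_le_const
      (lt_add_one _)⟩
  obtain ⟨L, hL⟩ : ∃ L, ∀ᶠ z in 𝓝 c, ‖V z‖ ≤ L :=
    ⟨_, (hV.differentiableAt (hU.mem_nhds hc)).continuousAt.norm.eventually_le_const
      (lt_add_one _)⟩
  obtain ⟨R, hR, hball⟩ := Metric.eventually_nhds_iff_ball.1 ((hM.and hL).and (hU.mem_nhds hc))
  have hsub : ∀ z ∈ Metric.ball c (R / 2), Metric.ball z (R / 2) ⊆ Metric.ball c R := fun z hz =>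
    Metric.ball_subset_ball' (by linarith [Metric.mem_ball.1 hz])
  have hself : Metric.ball c (R / 2) ⊆ Metric.ball c R := Metric.ball_subset_ball (by linarith)
  have hhR : DifferentiableOn ℂ h (Metric.ball c R) := hh.mono fun z hz => (hball z hz).2
  have hVR : DifferentiableOn ℂ V (Metric.ball c (R / 2)) :=
    hV.mono fun z hz => (hball z (hself hz)).2
  have hquot : ∀ᶠ t : ℂ in 𝓝[≠] 0, DifferentiableOn ℂ (fun z => t⁻¹ • (h (z + t • V z) - h z))
      (Metric.ball c (R / 2)) := by
    have hsmall : ∀ᶠ t : ℂ in 𝓝 0, ‖t‖ * L < R / 2 :=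
      (by fun_prop : Continuous fun t : ℂ => ‖t‖ * L).continuousAt.eventually_lt_const (by simpa)
    filter_upwards [nhdsWithin_le_nhds hsmall] with t ht
    refine ((hhR.comp (differentiableOn_id.fun_add (hVR.fun_const_smul t)) fun z hz => ?_).sub
      (hhR.mono hself)).const_smul _
    refine hsub z hz (mem_ball_iff_norm.2 ?_)
    rw [id, add_sub_cancel_left, norm_smul]
    exact lt_of_le_of_lt (by gcongr; exact (hball z (hself hz)).1.2) ht
  have hlim := tendstoUniformlyOn_inv_smul_sub (V := V) (half_pos hR)
    (fun z hz => hhR.mono (hsub z hz)) (fun z hz w hw => (hball w (hsub z hz hw)).1.1)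
    fun z hz => (hball z (hself hz)).1.2
  exact ((differentiableOn_of_tendstoUniformlyOn Metric.isOpen_ball hlim hquot).differentiableAt
    (Metric.ball_mem_nhds c (half_pos hR))).differentiableWithinAt

end Holomorphic

section Taylor

variable {E F : Type*} [NormedAddCommGroup E] [NormedSpace ℂ E] [NormedAddCommGroup F]
  [NormedSpace ℂ F] {U : Set E} {h : E → F} {R : ℝ}

/-- The homogeneous component of degree `p` in the Taylor expansion of `h` at the origin, read off
from the restrictions of `h` to complex lines. -/
noncomputable def taylorComponent (h : E → F) (p : ℕ) (z : E) : F :=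
  (p ! : ℂ)⁻¹ • iteratedDeriv p (fun l : ℂ => h (l • z)) 0

/-- The Euler derivative `∑ⱼ zⱼ ∂h/∂zⱼ` of a holomorphic function `h`. -/
noncomputable def eulerDeriv (h : E → F) (z : E) : F := fderiv ℂ h z z

lemma hasDerivAt_comp_smul {l : ℂ} {z : E} (hd : DifferentiableAt ℂ h (l • z)) :
    HasDerivAt (fun l : ℂ => h (l • z)) (fderiv ℂ h (l • z) z) l := by
  have hline : HasDerivAt (fun l : ℂ => l • z) z l := by
    simpa using (hasDerivAt_id l).smul_const z
  exact hd.hasFDerivAt.comp_hasDerivAt l hline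

lemma differentiableOn_comp_smul (hh : DifferentiableOn ℂ h (Metric.ball 0 R)) {z : E} {r : ℝ}
    (hr : r * ‖z‖ < R) : DifferentiableOn ℂ (fun l : ℂ => h (l • z)) (Metric.closedBall 0 r) := by
  intro l hl
  have hmem : l • z ∈ Metric.ball 0 R := by
    rw [mem_ball_zero_iff, norm_smul]
    exact lt_of_le_of_lt (by gcongr; exact mem_closedBall_zero_iff.1 hl) hr
  exact (hasDerivAt_comp_smul (hh.differentiableAt (Metric.isOpen_ball.mem_nhds
    hmem))).differentiableAt.differentiableWithinAt

lemma eventually_hasDerivAt_comp_smul (hU : U ∈ 𝓝 0) (hh : DifferentiableOn ℂ h U) (z : E) :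
    ∀ᶠ l : ℂ in 𝓝 0, HasDerivAt (fun l : ℂ => h (l • z)) (fderiv ℂ h (l • z) z) l := by
  have hline : Tendsto (fun l : ℂ => l • z) (𝓝 0) (𝓝 0) := by
    simpa using (by fun_prop : Continuous fun l : ℂ => l • z).tendsto 0
  filter_upwards [hline.eventually (hh.eventually_differentiableAt hU)] with l hl
    using hasDerivAt_comp_smul hl

variable [CompleteSpace F]

lemma analyticAt_comp_smul (hU : U ∈ 𝓝 0) (hh : DifferentiableOn ℂ h U) (z : E) :
    AnalyticAt ℂ (fun l : ℂ => h (l • z)) 0 :=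
  Complex.analyticAt_iff_eventually_differentiableAt.2 <|
    (eventually_hasDerivAt_comp_smul hU hh z).mono fun _ hl => hl.differentiableAt

lemma hasSum_taylorComponent (hh : DifferentiableOn ℂ h (Metric.ball 0 R)) {z : E}
    (hz : z ∈ Metric.ball 0 R) : HasSum (fun p => taylorComponent h p z) (h z) := by
  obtain ⟨r, hr, hrz⟩ : ∃ r : ℝ, 1 < r ∧ r * ‖z‖ < R := by
    have : ∀ᶠ r : ℝ in 𝓝[>] 1, r * ‖z‖ < R := nhdsWithin_le_nhds <|
      (by fun_prop : Continuous fun r : ℝ => r * ‖z‖).continuousAt.eventually_lt_const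
        (by simpa using hz)
    exact (eventually_mem_nhdsWithin.and this).exists
  simpa [taylorComponent] using Complex.hasSum_taylorSeries_on_ball
    ((differentiableOn_comp_smul hh hrz).mono Metric.ball_subset_closedBall) (z := 1)
    (by simpa using hr)

lemma norm_taylorComponent_le {ρ M : ℝ} (hρ : 0 < ρ)
    (hh : DifferentiableOn ℂ h (Metric.ball 0 R)) (hρR : ρ < R)
    (hM : ∀ w ∈ Metric.closedBall 0 ρ, ‖h w‖ ≤ M) (p : ℕ) {r : ℝ} (hr : 0 < r) {z : E}
    (hz : ‖z‖ ≤ r) : ‖taylorComponent h p z‖ ≤ M * (r / ρ) ^ p := by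
  have hle : ρ / r * ‖z‖ ≤ ρ := by
    calc ρ / r * ‖z‖ ≤ ρ / r * r := by gcongr
      _ = ρ := by field_simp
  have hcauchy := Complex.norm_iteratedDeriv_le_of_forall_mem_sphere_norm_le (c := 0) (R := ρ / r)
    (C := M) (f := fun l : ℂ => h (l • z)) p (by positivity)
    (DifferentiableOn.diffContOnCl (by
      rw [closure_ball _ (by positivity)]
      exact differentiableOn_comp_smul hh (hle.trans_lt hρR)))
    (fun l hl => hM _ (by
      rw [mem_closedBall_zero_iff, norm_smul, mem_sphere_zero_iff_norm.1 hl]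
      exact hle))
  rw [taylorComponent, norm_smul, norm_inv, Complex.norm_natCast, inv_mul_le_iff₀ (by positivity)]
  refine hcauchy.trans_eq ?_
  rw [div_pow, div_pow]
  field_simp

theorem tendstoLocallyUniformlyOn_sum_taylorComponent [ProperSpace E]
    (hh : DifferentiableOn ℂ h (Metric.ball 0 R)) :
    TendstoLocallyUniformlyOn (fun (N : ℕ) z => ∑ p ∈ Finset.range N, taylorComponent h p z) h
      atTop (Metric.ball 0 R) := by
  intro V hV z₀ hz₀
  obtain ⟨r, hr, hrR⟩ := exists_between (mem_ball_zero_iff.1 hz₀)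
  obtain ⟨ρ, hrρ, hρR⟩ := exists_between hrR
  have hr0 : 0 < r := (norm_nonneg _).trans_lt hr
  have hρ0 : 0 < ρ := hr0.trans hrρ
  obtain ⟨M, hM⟩ := (isCompact_closedBall (0 : E) ρ).exists_bound_of_continuousOn
    (f := h) (hh.continuousOn.mono (Metric.closedBall_subset_ball hρR))
  have hunif := tendstoUniformlyOn_tsum_nat (f := fun p z => taylorComponent h p z)
    (u := fun p => M * (r / ρ) ^ p) (s := Metric.ball (0 : E) r)
    ((summable_geometric_of_lt_one (by positivity) ((div_lt_one hρ0).2 hrρ)).mul_left M)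
    fun p z hz => norm_taylorComponent_le hρ0 hh hρR hM p hr0 (mem_ball_zero_iff.1 hz).le
  refine ⟨Metric.ball (0 : E) r, mem_nhdsWithin_of_mem_nhds
    (Metric.isOpen_ball.mem_nhds (by simpa using hr)), ?_⟩
  filter_upwards [hunif V hV] with N hN z hz
  simpa only [(hasSum_taylorComponent hh (Metric.ball_subset_ball hrR.le hz)).tsum_eq] using hN z hz

lemma differentiableOn_eulerDeriv (hU : IsOpen U) (hh : DifferentiableOn ℂ h U) :
    DifferentiableOn ℂ (eulerDeriv h) U :=
  differentiableOn_fderiv_apply hU hh differentiableOn_id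

lemma differentiableOn_iterate_eulerDeriv (hU : IsOpen U) (hh : DifferentiableOn ℂ h U) (m : ℕ) :
    DifferentiableOn ℂ (eulerDeriv^[m] h) U := by
  induction m with
  | zero => exact hh
  | succ m ih =>
    rw [Function.iterate_succ_apply']
    exact differentiableOn_eulerDeriv hU ih

lemma taylorComponent_eulerDeriv (hU : U ∈ 𝓝 0) (hh : DifferentiableOn ℂ h U) (p : ℕ) (z : E) :
    taylorComponent (eulerDeriv h) p z = (p : ℂ) • taylorComponent h p z := by
  have hslice : (fun l : ℂ => eulerDeriv h (l • z)) =ᶠ[𝓝 0]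
      ((fun l : ℂ => l) • deriv fun l : ℂ => h (l • z)) := by
    filter_upwards [eventually_hasDerivAt_comp_smul hU hh z] with l hl
    simp [eulerDeriv, hl.deriv]
  have hleibniz := iteratedDerivWithin_smul (n := p) (Set.mem_univ (0 : ℂ)) uniqueDiffOn_univ
    (contDiffAt_fun_id (𝕜 := ℂ)).contDiffWithinAt
    (analyticAt_comp_smul hU hh z).deriv.contDiffAt.contDiffWithinAt
  simp only [iteratedDerivWithin_univ] at hleibniz
  rw [taylorComponent, hslice.iteratedDeriv_eq, hleibniz]
  rcases p with _ | p
  · simp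
  · rw [Finset.sum_eq_single 1]
    · rw [iteratedDeriv_one, deriv_id'', Nat.choose_one_right, one_smul, taylorComponent,
        add_tsub_cancel_right, iteratedDeriv_succ', ← Nat.cast_smul_eq_nsmul ℂ, smul_comm]
    · intro b _ hb
      simp [iteratedDeriv_fun_id_zero, hb]
    · simp

lemma taylorComponent_iterate_eulerDeriv (hU : IsOpen U) (h0 : 0 ∈ U)
    (hh : DifferentiableOn ℂ h U) (m p : ℕ) (z : E) :
    taylorComponent (eulerDeriv^[m] h) p z = (p : ℂ) ^ m • taylorComponent h p z := by
  induction m with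
  | zero => simp
  | succ m ih =>
    rw [Function.iterate_succ_apply', taylorComponent_eulerDeriv (hU.mem_nhds h0)
      (differentiableOn_iterate_eulerDeriv hU hh m), ih, smul_smul, pow_succ']

end Taylor

section SolidHarmonics

variable {n : ℕ} {U : Set (Cn n)} {h : Cn n → ℂ}

lemma sum_smul_stdVec (z : Cn n) : ∑ j, z j • stdVec n j = z := by
  ext i
  simp [stdVec, Finset.sum_apply, Pi.single_apply]

lemma apply_eq_sum_smul_stdVec {M 𝓕 : Type*} [AddCommMonoid M] [Module ℂ M] [FunLike 𝓕 (Cn n) M]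
    [LinearMapClass 𝓕 ℂ (Cn n) M] (A : 𝓕) (z : Cn n) : A z = ∑ j, z j • A (stdVec n j) := by
  conv_lhs => rw [← sum_smul_stdVec z]
  simp only [map_sum, map_smul]

lemma eval_const_mul_of_isHomogeneous {σ R : Type*} [CommSemiring R] {p : ℕ}
    {P : MvPolynomial σ R} (hP : P.IsHomogeneous p) (c : R) (x : σ → R) :
    MvPolynomial.eval (fun j => c * x j) P = c ^ p * MvPolynomial.eval x P := by
  rw [MvPolynomial.eval_eq, MvPolynomial.eval_eq, Finset.mul_sum]
  refine Finset.sum_congr rfl fun d hd => ?_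
  have hdeg : ∑ i ∈ d.support, d i = p := by
    simpa [Finsupp.weight_apply, Finsupp.sum] using hP (MvPolynomial.mem_support_iff.1 hd)
  rw [← hdeg, ← Finset.prod_pow_eq_pow_sum, mul_left_comm, ← Finset.prod_mul_distrib]
  simp only [mul_pow]

lemma apply_smul_of_mem_solidHol {p : ℕ} {u : Cn n → ℂ} (hu : u ∈ solidHol n p) (c : ℂ) (z : Cn n) :
    u (c • z) = c ^ p * u z := by
  obtain ⟨P, hP, hu⟩ := hu
  rw [hu, hu, ← eval_const_mul_of_isHomogeneous hP]
  simp

lemma conj_mem_solidAnti {p : ℕ} {u : Cn n → ℂ} (hu : u ∈ solidHol n p) :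
    (fun z => conj (u z)) ∈ solidAnti n p := by
  obtain ⟨P, hP, hu⟩ := hu
  refine ⟨MvPolynomial.map (starRingEnd ℂ) P, hP.map _, fun z => ?_⟩
  simp only [hu, MvPolynomial.eval_map]
  rw [MvPolynomial.eval, MvPolynomial.coe_eval₂Hom, MvPolynomial.hom_eval₂]
  rfl

lemma apply_smul_of_mem_solidAnti {q : ℕ} {v : Cn n → ℂ} (hv : v ∈ solidAnti n q) (c : ℂ)
    (z : Cn n) : v (c • z) = conj c ^ q * v z := by
  obtain ⟨P, hP, hv⟩ := hv
  rw [hv, hv, ← eval_const_mul_of_isHomogeneous hP]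
  simp

lemma iteratedDeriv_comp_smul_mem_solidHol (p : ℕ) (hU : IsOpen U) (h0 : 0 ∈ U)
    (hh : DifferentiableOn ℂ h U) :
    (fun z : Cn n => iteratedDeriv p (fun l : ℂ => h (l • z)) 0) ∈ solidHol n p := by
  induction p generalizing h with
  | zero => exact ⟨MvPolynomial.C (h 0), MvPolynomial.isHomogeneous_C _ _, by simp⟩
  | succ p ih =>
    have hpartial : ∀ j, DifferentiableOn ℂ (fun w => fderiv ℂ h w (stdVec n j)) U := fun j =>
      differentiableOn_fderiv_apply hU hh (differentiableOn_const _)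
    choose P hP hPeval using fun j => ih (hpartial j)
    refine ⟨∑ j, MvPolynomial.X j * P j, MvPolynomial.IsHomogeneous.sum _ _ _ fun j _ => by
      simpa only [add_comm] using (MvPolynomial.isHomogeneous_X ℂ j).mul (hP j), fun z => ?_⟩
    have hderiv : deriv (fun l : ℂ => h (l • z)) =ᶠ[𝓝 0]
        fun l => ∑ j, z j * fderiv ℂ h (l • z) (stdVec n j) := by
      filter_upwards [eventually_hasDerivAt_comp_smul (hU.mem_nhds h0) hh z] with l hl
      rw [hl.deriv, apply_eq_sum_smul_stdVec]
      simp only [smul_eq_mul]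
    have hanalytic := fun j => analyticAt_comp_smul (hU.mem_nhds h0) (hpartial j) z
    change iteratedDeriv (p + 1) _ 0 = _
    rw [iteratedDeriv_succ', hderiv.iteratedDeriv_eq,
      iteratedDeriv_fun_sum fun j _ => (contDiffAt_const.mul (hanalytic j).contDiffAt)]
    simp only [map_sum, map_mul, MvPolynomial.eval_X, iteratedDeriv_const_mul_field, ← hPeval]

theorem taylorComponent_mem_solidHol (p : ℕ) (hU : IsOpen U) (h0 : 0 ∈ U)
    (hh : DifferentiableOn ℂ h U) : taylorComponent h p ∈ solidHol n p := by
  obtain ⟨P, hP, hPeval⟩ := iteratedDeriv_comp_smul_mem_solidHol p hU h0 hh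
  refine ⟨MvPolynomial.C (p ! : ℂ)⁻¹ * P, by simpa using (MvPolynomial.isHomogeneous_C _ _).mul hP,
    fun z => ?_⟩
  simp [taylorComponent, hPeval]

end SolidHarmonics

section ComplexLinearPart

variable {E F : Type*} [NormedAddCommGroup E] [NormedSpace ℂ E] [NormedAddCommGroup F]
  [NormedSpace ℂ F]

lemma map_complex_smul (A : E →L[ℝ] F) (c : ℂ) (v : E) :
    A (c • v) = c.re • A v + c.im • A (Complex.I • v) := by
  conv_lhs => rw [← Complex.re_add_im c, add_smul, mul_smul]
  simp only [map_add, Complex.coe_smul, map_smul]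

/-- The complex linear part `v ↦ (A v - i A (i v)) / 2` of a real linear map `A`, as a continuous
function of `A`. -/
noncomputable def complexLinearPart : (E →L[ℝ] F) →L[ℝ] (E →L[ℂ] F) :=
  LinearMap.mkContinuous
    { toFun A :=
        { toFun v := (2 : ℂ)⁻¹ • (A v - Complex.I • A (Complex.I • v))
          map_add' v w := by simp only [smul_add, map_add]; module
          map_smul' c v := by
            have hI : Complex.I • c • v = c • Complex.I • v := smul_comm _ _ _
            rw [hI, map_complex_smul A c v, map_complex_smul A c (Complex.I • v)]
            simp only [smul_smul Complex.I Complex.I, Complex.I_mul_I, neg_smul, one_smul, map_neg,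
              RingHom.id_apply]
            conv_rhs => rw [← Complex.re_add_im c]
            simp only [← Complex.coe_smul]
            match_scalars
            · ring
            · linear_combination (2 : ℂ)⁻¹ * c.im * Complex.I_sq
          cont := by fun_prop }
      map_add' A A' := by ext v; simp; module
      map_smul' c A := by
        ext v
        simp [smul_comm _ c, ← smul_sub] }
    1 fun A => by
      refine ContinuousLinearMap.opNorm_le_bound _ (by positivity) fun v => ?_
      calc ‖(2 : ℂ)⁻¹ • (A v - Complex.I • A (Complex.I • v))‖
          ≤ 2⁻¹ * (‖A v‖ + ‖Complex.I • A (Complex.I • v)‖) := by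
            rw [norm_smul, norm_inv, Complex.norm_ofNat]
            gcongr
            exact norm_sub_le _ _
        _ = 2⁻¹ * (‖A v‖ + ‖A (Complex.I • v)‖) := by rw [norm_smul, Complex.norm_I, one_mul]
        _ ≤ 2⁻¹ * (‖A‖ * ‖v‖ + ‖A‖ * ‖Complex.I • v‖) := by grw [A.le_opNorm, A.le_opNorm]
        _ = 1 * ‖A‖ * ‖v‖ := by
            rw [norm_smul, Complex.norm_I]
            ring

lemma complexLinearPart_apply (A : E →L[ℝ] F) (v : E) :
    complexLinearPart A v = (2 : ℂ)⁻¹ • (A v - Complex.I • A (Complex.I • v)) := rfl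

theorem exists_eq_add_conj_of_convex {f : E → ℂ} {s : Set E} (hs : Convex ℝ s) (hso : IsOpen s)
    (hf : ContDiffOn ℝ 2 f s)
    (hlevi : ∀ z ∈ s, ∀ v w, fderiv ℝ (fderiv ℝ f) z (Complex.I • v) (Complex.I • w) =
      -fderiv ℝ (fderiv ℝ f) z v w) :
    ∃ h k : E → ℂ, DifferentiableOn ℂ h s ∧ DifferentiableOn ℂ k s ∧
      ∀ z ∈ s, f z = h z + conj (k z) := by
  have hat : ∀ z ∈ s, ContDiffAt ℝ 2 f z := fun z hz => hf.contDiffAt (hso.mem_nhds hz)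
  have hpart : ∀ z ∈ s, HasFDerivAt (fun z => complexLinearPart (fderiv ℝ f z))
      (complexLinearPart ∘L fderiv ℝ (fderiv ℝ f) z) z := fun z hz =>
    (complexLinearPart (F := ℂ)).hasFDerivAt.comp z (((hat z hz).fderiv_right (m := 1)
      (by norm_num)).differentiableAt one_ne_zero).hasFDerivAt
  have hsymm : ∀ z ∈ s, ∀ v w,
      fderiv ℝ (fderiv ℝ f) z v w = fderiv ℝ (fderiv ℝ f) z w v := fun z hz v w =>
    (hat z hz).isSymmSndFDerivAt (by simp) v w
  -- The vanishing of the Levi form says that the complex linear part of `df` is a closed form.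
  obtain ⟨h, hh⟩ := hs.exists_forall_hasFDerivAt_of_fderiv_symmetric hso
    (fun z hz => (hpart z hz).differentiableAt.differentiableWithinAt) fun z hz v w => by
      have hswap := hlevi z hz v (Complex.I • w)
      rw [smul_smul, Complex.I_mul_I, neg_one_smul, map_neg, neg_inj, hsymm z hz _ w] at hswap
      simp only [(hpart z hz).fderiv, ContinuousLinearMap.comp_apply, complexLinearPart_apply]
      rw [hsymm z hz v w, hswap]
  refine ⟨h, fun z => conj (f z - h z),
    fun z hz => (hh z hz).differentiableAt.differentiableWithinAt, fun z hz => ?_,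
    fun z _ => by simp⟩
  have hreal : HasFDerivAt (fun z => conj (f z - h z)) ((Complex.conjCLE : ℂ →L[ℝ] ℂ) ∘L
      (fderiv ℝ f z - (complexLinearPart (fderiv ℝ f z)).restrictScalars ℝ)) z :=
    (Complex.conjCLE : ℂ →L[ℝ] ℂ).hasFDerivAt.comp z
      (((hat z hz).differentiableAt two_ne_zero).hasFDerivAt.sub ((hh z hz).restrictScalars ℝ))
  have hlinear : (complexLinearPart
      ((Complex.conjCLE : ℂ →L[ℝ] ℂ) ∘L fderiv ℝ f z)).restrictScalars ℝ =
        (Complex.conjCLE : ℂ →L[ℝ] ℂ) ∘L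
          (fderiv ℝ f z - (complexLinearPart (fderiv ℝ f z)).restrictScalars ℝ) := by
    ext v
    simp [complexLinearPart_apply, Complex.conj_ofNat]
    ring
  exact (hasFDerivAt_of_restrictScalars ℝ hreal hlinear).differentiableAt.differentiableWithinAt

end ComplexLinearPart

section Pluriharmonic

variable {n : ℕ} {f : Cn n → ℂ} {z : Cn n}

lemma ext_stdVec {F : Type*} [NormedAddCommGroup F] [NormedSpace ℂ F] {A A' : Cn n →L[ℝ] F}
    (h : ∀ j, A (stdVec n j) = A' (stdVec n j))
    (hI : ∀ j, A (Complex.I • stdVec n j) = A' (Complex.I • stdVec n j)) : A = A' := by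
  ext v
  rw [← sum_smul_stdVec v]
  simp only [map_sum, map_complex_smul _ (v _), h, hI]

lemma radialDeriv_eq_fderiv (n : ℕ) (f : Cn n → ℂ) (z : Cn n) :
    radialDeriv n f z = fderiv ℝ f z z := by
  conv_rhs => arg 2; rw [← sum_smul_stdVec z]
  rw [map_sum, radialDeriv]
  refine Finset.sum_congr rfl fun j _ => ?_
  simp only [wirtinger, wirtingerBar, map_complex_smul _ (z j), Complex.real_smul]
  have hconj : conj (z j) = (z j).re - (z j).im * Complex.I := by
    apply Complex.ext <;> simp
  rw [hconj]
  nth_rewrite 1 [← Complex.re_add_im (z j)]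
  linear_combination (-(z j).im * fderiv ℝ f z (Complex.I • stdVec n j)) * Complex.I_sq

lemma fderiv_wirtingerBar_apply (hf : ContDiffAt ℝ 2 f z) (k : Fin n) (v : Cn n) :
    fderiv ℝ (wirtingerBar n k f) z v = (fderiv ℝ (fderiv ℝ f) z v (stdVec n k) +
      Complex.I * fderiv ℝ (fderiv ℝ f) z v (Complex.I • stdVec n k)) / 2 := by
  have hfderiv : HasFDerivAt (fderiv ℝ f) (fderiv ℝ (fderiv ℝ f) z) z :=
    ((hf.fderiv_right (m := 1) (by norm_num)).differentiableAt one_ne_zero).hasFDerivAt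
  have happly : ∀ w, HasFDerivAt (fun z => fderiv ℝ f z w)
      ((ContinuousLinearMap.apply ℝ ℂ w).comp (fderiv ℝ (fderiv ℝ f) z)) z := fun w =>
    (ContinuousLinearMap.apply ℝ ℂ w).hasFDerivAt.comp z hfderiv
  have hbar := ((happly (stdVec n k)).fun_add
    ((happly (Complex.I • stdVec n k)).const_mul Complex.I)).mul_const (2 : ℂ)⁻¹
  simp only [← div_eq_mul_inv] at hbar
  change fderiv ℝ (fun z => _) z v = _
  simp only [wirtingerBar]
  rw [hbar.fderiv]
  simp [div_eq_inv_mul, mul_add]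

lemma IsPluriharmonic.fderiv_fderiv_smul_I (hf : IsPluriharmonic n f) (hz : z ∈ unitBall n)
    (v w : Cn n) : fderiv ℝ (fderiv ℝ f) z (Complex.I • v) (Complex.I • w) =
      -fderiv ℝ (fderiv ℝ f) z v w := by
  have hat : ContDiffAt ℝ 2 f z := hf.1.contDiffAt (Metric.isOpen_ball.mem_nhds hz)
  set B := fderiv ℝ (fderiv ℝ f) z
  have hsymm : ∀ v w, B v w = B w v := hat.isSymmSndFDerivAt (by simp)
  have hmixed : ∀ j k, B (stdVec n j) (stdVec n k) +
      Complex.I * B (stdVec n j) (Complex.I • stdVec n k) -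
      Complex.I * (B (Complex.I • stdVec n j) (stdVec n k) +
        Complex.I * B (Complex.I • stdVec n j) (Complex.I • stdVec n k)) = 0 := fun j k => by
    have hlevi := hf.2 z hz j k
    rw [wirtinger, fderiv_wirtingerBar_apply hat, fderiv_wirtingerBar_apply hat] at hlevi
    linear_combination 4 * hlevi
  have hdiag : ∀ j k, B (Complex.I • stdVec n j) (Complex.I • stdVec n k) =
      -B (stdVec n j) (stdVec n k) := fun j k => by
    have hjk := hmixed j k
    have hkj := hmixed k j
    rw [hsymm (stdVec n k), hsymm (stdVec n k), hsymm (Complex.I • stdVec n k),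
      hsymm (Complex.I • stdVec n k)] at hkj
    linear_combination (hjk + hkj) / 2 +
      B (Complex.I • stdVec n j) (Complex.I • stdVec n k) * Complex.I_sq
  have hoff : ∀ j k, B (Complex.I • stdVec n j) (stdVec n k) =
      B (stdVec n j) (Complex.I • stdVec n k) := fun j k => by
    have hjk := hmixed j k
    rw [hdiag] at hjk
    linear_combination Complex.I * hjk + (B (Complex.I • stdVec n j) (stdVec n k) -
      B (stdVec n j) (Complex.I • stdVec n k) - Complex.I * B (stdVec n j) (stdVec n k)) *
        Complex.I_sq
  let J : Cn n →L[ℝ] Cn n := (Complex.I • ContinuousLinearMap.id ℂ (Cn n)).restrictScalars ℝ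
  suffices h : (B ∘L J).flip ∘L J = -B.flip from
    DFunLike.congr_fun (DFunLike.congr_fun h w) v
  refine ext_stdVec (fun k => ext_stdVec (fun j => ?_) fun j => ?_) fun k =>
    ext_stdVec (fun j => ?_) fun j => ?_
  all_goals simp [J, smul_smul, hdiag, hoff]

/-- `f` is the sum of the holomorphic function `h` and the conjugate of the holomorphic function
`k`, which is normalized by `k 0 = 0`. -/
structure IsHolAddConj (n : ℕ) (f h k : Cn n → ℂ) : Prop where
  hol : DifferentiableOn ℂ h (unitBall n)
  hol_conj : DifferentiableOn ℂ k (unitBall n)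
  conj_zero : k 0 = 0
  eq_add : ∀ z ∈ unitBall n, f z = h z + conj (k z)

theorem IsPluriharmonic.exists_isHolAddConj (hf : IsPluriharmonic n f) :
    ∃ h k, IsHolAddConj n f h k := by
  obtain ⟨h, k, hh, hk, hadd⟩ := exists_eq_add_conj_of_convex (convex_ball 0 1)
    Metric.isOpen_ball hf.1 fun z hz => hf.fderiv_fderiv_smul_I hz
  exact ⟨fun z => h z + conj (k 0), fun z => k z - k 0, hh.add_const _, hk.sub_const _,
    sub_self _, fun z hz => by simp [hadd z hz]⟩

namespace IsHolAddConj

variable {h k : Cn n → ℂ}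

lemma hasFDerivAt (H : IsHolAddConj n f h k) (hz : z ∈ unitBall n) :
    HasFDerivAt f ((fderiv ℂ h z).restrictScalars ℝ +
      (Complex.conjCLE : ℂ →L[ℝ] ℂ).comp ((fderiv ℂ k z).restrictScalars ℝ)) z := by
  have hU : unitBall n ∈ 𝓝 z := Metric.isOpen_ball.mem_nhds hz
  have hh := (H.hol.differentiableAt hU).hasFDerivAt.restrictScalars ℝ
  have hk := (Complex.conjCLE : ℂ →L[ℝ] ℂ).hasFDerivAt.comp z
    ((H.hol_conj.differentiableAt hU).hasFDerivAt.restrictScalars ℝ)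
  exact (hh.add hk).congr_of_eventuallyEq (Filter.mem_of_superset hU H.eq_add)

lemma continuousOn (H : IsHolAddConj n f h k) : ContinuousOn f (unitBall n) := fun _ hz =>
  (H.hasFDerivAt hz).continuousAt.continuousWithinAt

lemma radialDeriv (H : IsHolAddConj n f h k) :
    IsHolAddConj n (radialDeriv n f) (eulerDeriv h) (eulerDeriv k) where
  hol := differentiableOn_eulerDeriv Metric.isOpen_ball H.hol
  hol_conj := differentiableOn_eulerDeriv Metric.isOpen_ball H.hol_conj
  conj_zero := by simp [eulerDeriv]
  eq_add z hz := by simp [radialDeriv_eq_fderiv, (H.hasFDerivAt hz).fderiv, eulerDeriv]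

lemma iterate_radialDeriv (H : IsHolAddConj n f h k) (m : ℕ) :
    IsHolAddConj n ((_root_.radialDeriv n)^[m] f) (eulerDeriv^[m] h) (eulerDeriv^[m] k) := by
  induction m with
  | zero => exact H
  | succ m ih => simpa only [Function.iterate_succ_apply'] using ih.radialDeriv

lemma isPeterWeyl (H : IsHolAddConj n f h k) :
    IsPeterWeyl n f (taylorComponent h) (fun p z => conj (taylorComponent k p z)) where
  hol p := taylorComponent_mem_solidHol p Metric.isOpen_ball (Metric.mem_ball_self one_pos) H.hol
  anti q := conj_mem_solidAnti <|
    taylorComponent_mem_solidHol q Metric.isOpen_ball (Metric.mem_ball_self one_pos) H.hol_conj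
  anti_zero := by
    ext z
    simp [taylorComponent, H.conj_zero]
  tendsto := by
    have hconj : TendstoLocallyUniformlyOn
        (fun (N : ℕ) z => conj (∑ p ∈ Finset.range N, taylorComponent k p z)) (fun z => conj (k z))
        atTop (unitBall n) :=
      Complex.isometry_conj.uniformContinuous.comp_tendstoLocallyUniformlyOn
        (tendstoLocallyUniformlyOn_sum_taylorComponent H.hol_conj)
    refine (((tendstoLocallyUniformlyOn_sum_taylorComponent H.hol).add hconj).congr
      fun N z _ => ?_).congr_right fun z hz => (H.eq_add z hz).symm
    simp [Finset.sum_add_distrib]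

end IsHolAddConj

end Pluriharmonic

section Fourier

variable {T : ℝ} [Fact (0 < T)]

lemma norm_fourierCoeff_le {E : Type*} [NormedAddCommGroup E] [NormedSpace ℂ E]
    {g : AddCircle T → E} {C : ℝ} (hg : ∀ t, ‖g t‖ ≤ C) (j : ℤ) : ‖fourierCoeff g j‖ ≤ C := by
  refine (norm_integral_le_of_norm_le_const (C := C) (Eventually.of_forall fun t => ?_)).trans_eq
    (by simp)
  have hmode : ‖fourier (-j) t‖ = 1 := Circle.norm_coe _
  rw [norm_smul, hmode, one_mul]
  exact hg t

lemma tendsto_fourierCoeff_of_tendstoUniformly {E ι : Type*} [NormedAddCommGroup E]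
    [NormedSpace ℂ E] {F : ι → AddCircle T → E} {g : AddCircle T → E} {l : Filter ι} [NeBot l]
    (hF : ∀ i, Continuous (F i)) (h : TendstoUniformly F g l) (j : ℤ) :
    Tendsto (fun i => fourierCoeff (F i) j) l (𝓝 (fourierCoeff g j)) := by
  have hint : ∀ {f : AddCircle T → E}, Continuous f → Integrable f AddCircle.haarAddCircle :=
    fun hf => hf.integrable_of_hasCompactSupport (HasCompactSupport.of_compactSpace _)
  have hg : Continuous g := h.continuous (Frequently.of_forall hF)
  refine Metric.tendsto_nhds.2 fun ε hε => ?_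
  filter_upwards [Metric.tendstoUniformly_iff.1 h (ε / 2) (half_pos hε)] with i hi
  have hsub : fourierCoeff (F i) j - fourierCoeff g j = fourierCoeff (F i - g) j := by
    simp only [fourierCoeff, Pi.sub_apply, smul_sub]
    exact (integral_sub (hint ((fourier _).continuous.smul (hF i)))
      (hint ((fourier _).continuous.smul hg))).symm
  rw [dist_eq_norm, hsub]
  refine (norm_fourierCoeff_le (C := ε / 2) (fun t => ?_) j).trans_lt (half_lt_self hε)
  rw [Pi.sub_apply, ← dist_eq_norm, dist_comm]
  exact (hi t).le

lemma lintegral_enorm_sq_eq_tsum_fourierCoeff {g : AddCircle T → ℂ} (hg : Continuous g) :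
    ∫⁻ t, ‖g t‖ₑ ^ 2 ∂AddCircle.haarAddCircle = ∑' j : ℤ, ‖fourierCoeff g j‖ₑ ^ 2 := by
  set F : Lp ℂ 2 (AddCircle.haarAddCircle (T := T)) :=
    ContinuousMap.toLp 2 AddCircle.haarAddCircle ℂ ⟨g, hg⟩
  have hF : F =ᵐ[AddCircle.haarAddCircle] g := ContinuousMap.coeFn_toLp _ _
  have hparseval : HasSum (fun j => ‖fourierCoeff g j‖ ^ 2)
      (∫ t, ‖g t‖ ^ 2 ∂AddCircle.haarAddCircle) := by
    rw [← fourierCoeff_congr_ae hF, ← integral_congr_ae (f := fun t => ‖F t‖ ^ 2)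
      (hF.mono fun t ht => by simp only [ht])]
    exact hasSum_sq_fourierCoeff F
  have hint : Integrable (fun t => ‖g t‖ ^ 2) (AddCircle.haarAddCircle (T := T)) :=
    (hg.norm.pow 2).integrable_of_hasCompactSupport (HasCompactSupport.of_compactSpace _)
  have henorm : ∀ w : ℂ, ‖w‖ₑ ^ 2 = ENNReal.ofReal (‖w‖ ^ 2) := fun w => by
    rw [ENNReal.ofReal_pow (norm_nonneg _), ofReal_norm]
  simp only [henorm]
  rw [← ofReal_integral_eq_lintegral_ofReal hint (Eventually.of_forall fun t => by positivity),
    ← hparseval.tsum_eq, ENNReal.ofReal_tsum_of_nonneg (fun _ => by positivity) hparseval.summable]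

/-- The trigonometric polynomial `∑_{p < N} (a p e_p + b p e_{-p})`, where `e_p` is the `p`-th
Fourier mode. -/
noncomputable def trigSum (T : ℝ) (a b : ℕ → ℂ) (N : ℕ) : C(AddCircle T, ℂ) :=
  ∑ p ∈ Finset.range N, (a p • fourier (p : ℤ) + b p • fourier (-p : ℤ))

variable {a b : ℕ → ℂ} {g : AddCircle T → ℂ}

lemma fourierCoeff_trigSum (a b : ℕ → ℂ) (N : ℕ) (j : ℤ) :
    fourierCoeff (trigSum T a b N) j =
      ∑ p ∈ Finset.range N, ((if j = p then a p else 0) + if j = -p then b p else 0) := by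
  have hint : ∀ (c : ℂ) (i : ℤ), Integrable (c • ⇑(fourier (T := T) i)) AddCircle.haarAddCircle :=
    fun c i => ((fourier i).continuous.const_smul c).integrable_of_hasCompactSupport
      (HasCompactSupport.of_compactSpace _)
  have hcoe : ⇑(trigSum T a b N) = ∑ p ∈ Finset.range N,
      (a p • ⇑(fourier (T := T) (p : ℤ)) + b p • ⇑(fourier (T := T) (-p : ℤ))) := by
    ext t
    simp [trigSum]
  rw [hcoe, fourierCoeff.sum _ _ fun p _ => (hint _ _).add (hint _ _), Finset.sum_apply]
  refine Finset.sum_congr rfl fun p _ => ?_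
  rw [fourierCoeff.add (hint _ _) (hint _ _), Pi.add_apply, fourierCoeff.const_smul,
    fourierCoeff.const_smul, fourierCoeff_fourier, fourierCoeff_fourier]
  simp [Pi.single_apply]

lemma fourierCoeff_natCast_of_tendstoUniformly_trigSum (hb : b 0 = 0)
    (h : TendstoUniformly (fun N => ⇑(trigSum T a b N)) g atTop) (p : ℕ) :
    fourierCoeff g p = a p := by
  refine tendsto_nhds_unique
    (tendsto_fourierCoeff_of_tendstoUniformly (fun N => map_continuous _) h p)
    (tendsto_const_nhds.congr' ?_)
  filter_upwards [eventually_gt_atTop p] with N hN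
  have hanti : ∀ q : ℕ, (if (p : ℤ) = -q then b q else 0) = 0 := fun q =>
    ite_eq_right_iff.2 fun hq => by
      obtain rfl : q = 0 := by omega
      exact hb
  simp only [fourierCoeff_trigSum, hanti, Nat.cast_inj, add_zero, Finset.sum_ite_eq,
    Finset.mem_range, hN, if_true]

lemma fourierCoeff_neg_of_tendstoUniformly_trigSum
    (h : TendstoUniformly (fun N => ⇑(trigSum T a b N)) g atTop) (p : ℕ) :
    fourierCoeff g (-(p + 1)) = b (p + 1) := by
  refine tendsto_nhds_unique
    (tendsto_fourierCoeff_of_tendstoUniformly (fun N => map_continuous _) h _)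
    (tendsto_const_nhds.congr' ?_)
  filter_upwards [eventually_gt_atTop (p + 1)] with N hN
  have hhol : ∀ q : ℕ, -((p : ℤ) + 1) ≠ q := fun q => by omega
  have hanti : ∀ q : ℕ, -((p : ℤ) + 1) = -q ↔ p + 1 = q := fun q => by omega
  simp only [fourierCoeff_trigSum, hhol, hanti, if_false, zero_add, Finset.sum_ite_eq,
    Finset.mem_range, hN, if_true]

lemma lintegral_enorm_sq_of_tendstoUniformly_trigSum (hb : b 0 = 0)
    (h : TendstoUniformly (fun N => ⇑(trigSum T a b N)) g atTop) :
    ∫⁻ t, ‖g t‖ₑ ^ 2 ∂AddCircle.haarAddCircle = ∑' p, (‖a p‖ₑ ^ 2 + ‖b p‖ₑ ^ 2) := by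
  have hg : Continuous g := h.continuous (Frequently.of_forall fun N => map_continuous _)
  rw [lintegral_enorm_sq_eq_tsum_fourierCoeff hg,
    tsum_of_nat_of_neg_add_one ENNReal.summable ENNReal.summable, ENNReal.tsum_add,
    tsum_eq_zero_add' (f := fun p => ‖b p‖ₑ ^ 2) ENNReal.summable]
  simp only [fourierCoeff_natCast_of_tendstoUniformly_trigSum hb h,
    fourierCoeff_neg_of_tendstoUniformly_trigSum h]
  simp [hb]

end Fourier

section CircleSlice

variable {n : ℕ} {f : Cn n → ℂ} {u v u' v' : ℕ → Cn n → ℂ} {z : Cn n}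

lemma circle_smul_mem_unitBall_iff (c : Circle) : (c : ℂ) • z ∈ unitBall n ↔ z ∈ unitBall n := by
  rw [mem_ball_zero_iff, mem_ball_zero_iff, norm_smul, Circle.norm_coe, one_mul]

/-- The restriction of `f` to the circle through `z` centred at the origin, parametrized by
`t ↦ e^{2πit} z`. -/
noncomputable def circleSlice (f : Cn n → ℂ) (z : Cn n) (t : UnitAddCircle) : ℂ :=
  f ((AddCircle.toCircle t : ℂ) • z)

lemma continuous_toCircle_smul :
    Continuous fun q : UnitAddCircle × Cn n => (AddCircle.toCircle q.1 : ℂ) • q.2 :=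
  (continuous_subtype_val.comp (AddCircle.continuous_toCircle.comp continuous_fst)).smul
    continuous_snd

namespace IsPeterWeyl

lemma tendstoUniformly_trigSum (H : IsPeterWeyl n f u v) (hz : z ∈ unitBall n) :
    TendstoUniformly (fun N => ⇑(trigSum 1 (fun p => u p z) (fun p => v p z) N))
      (circleSlice f z) atTop := by
  have hslice : ∀ N, ⇑(trigSum 1 (fun p => u p z) (fun p => v p z) N) =
      circleSlice (fun z => ∑ p ∈ Finset.range N, (u p z + v p z)) z := fun N => by
    ext t
    simp [trigSum, circleSlice, apply_smul_of_mem_solidHol (H.hol _),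
      apply_smul_of_mem_solidAnti (H.anti _), AddCircle.toCircle_nsmul, AddCircle.toCircle_neg,
      ← Circle.coe_inv_eq_conj, mul_comm]
  have hrange := (tendstoLocallyUniformlyOn_iff_forall_isCompact Metric.isOpen_ball).1 H.tendsto
    (Set.range fun t : UnitAddCircle => (AddCircle.toCircle t : ℂ) • z)
    (by
      rintro _ ⟨t, rfl⟩
      exact (circle_smul_mem_unitBall_iff _).2 hz)
    (isCompact_range (continuous_toCircle_smul.comp (Continuous.prodMk_left z)))
  simp only [hslice]
  intro V hV
  filter_upwards [hrange V hV] with N hN t using hN _ ⟨t, rfl⟩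

lemma lintegral_circleSlice (H : IsPeterWeyl n f u v) (hz : z ∈ unitBall n) :
    ∫⁻ t, ‖circleSlice f z t‖ₑ ^ 2 ∂AddCircle.haarAddCircle =
      ∑' p, (‖u p z‖ₑ ^ 2 + ‖v p z‖ₑ ^ 2) :=
  lintegral_enorm_sq_of_tendstoUniformly_trigSum (by simp [H.anti_zero])
    (H.tendstoUniformly_trigSum hz)

end IsPeterWeyl

lemma eq_of_eqOn_unitBall {a b : Cn n → ℂ} {χ : ℂ → ℂ} (hχ : ∀ c ≠ 0, χ c ≠ 0)
    (ha : ∀ c z, a (c • z) = χ c * a z) (hb : ∀ c z, b (c • z) = χ c * b z)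
    (h : Set.EqOn a b (unitBall n)) : a = b := by
  funext z
  obtain ⟨r, hr, hrz⟩ := exists_pos_mul_lt one_pos ‖z‖
  have hr' : (r : ℂ) ≠ 0 := by exact_mod_cast hr.ne'
  have hmem : (r : ℂ) • z ∈ unitBall n := by
    rwa [mem_ball_zero_iff, norm_smul, Complex.norm_real, Real.norm_of_nonneg hr.le, mul_comm]
  exact mul_left_cancel₀ (hχ _ hr') (by rw [← ha, ← hb, h hmem])

theorem IsPeterWeyl.unique (H : IsPeterWeyl n f u v) (H' : IsPeterWeyl n f u' v') :
    u = u' ∧ v = v' := by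
  constructor
  · funext p
    refine eq_of_eqOn_unitBall (χ := fun c => c ^ p) (fun c hc => pow_ne_zero _ hc)
      (apply_smul_of_mem_solidHol (H.hol p)) (apply_smul_of_mem_solidHol (H'.hol p)) fun z hz => ?_
    rw [← fourierCoeff_natCast_of_tendstoUniformly_trigSum (by simp [H.anti_zero])
        (H.tendstoUniformly_trigSum hz),
      ← fourierCoeff_natCast_of_tendstoUniformly_trigSum (by simp [H'.anti_zero])
        (H'.tendstoUniformly_trigSum hz)]
  · funext p
    rcases p with _ | p
    · rw [H.anti_zero, H'.anti_zero]
    refine eq_of_eqOn_unitBall (χ := fun c => conj c ^ (p + 1))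
      (fun c hc => pow_ne_zero _ (by simpa using hc)) (apply_smul_of_mem_solidAnti (H.anti _))
      (apply_smul_of_mem_solidAnti (H'.anti _)) fun z hz => ?_
    rw [← fourierCoeff_neg_of_tendstoUniformly_trigSum (H.tendstoUniformly_trigSum hz),
      ← fourierCoeff_neg_of_tendstoUniformly_trigSum (H'.tendstoUniformly_trigSum hz)]

end CircleSlice

section Polar

variable {E : Type*} [NormedAddCommGroup E] [NormedSpace ℝ E] [FiniteDimensional ℝ E]
  [Nontrivial E] [MeasurableSpace E] [BorelSpace E] (μ : Measure E) [μ.IsAddHaarMeasure]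

lemma lintegral_eq_lintegral_toSphere_mul {F : E → ℝ≥0∞} {A : Metric.sphere (0 : E) 1 → ℝ≥0∞}
    {B : ℝ → ℝ≥0∞} (hA : Measurable A) (hB : Measurable B)
    (hF : ∀ (ζ : Metric.sphere (0 : E) 1) (r : ℝ), 0 < r → F (r • (ζ : E)) = A ζ * B r) :
    ∫⁻ z, F z ∂μ = (∫⁻ ζ, A ζ ∂μ.toSphere) *
      ∫⁻ r in Set.Ioi (0 : ℝ), ENNReal.ofReal (r ^ (Module.finrank ℝ E - 1)) * B r := by
  let Φ := homeomorphUnitSphereProd E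
  have hpolar : ∀ x : ({0}ᶜ : Set E), F x = A (Φ x).1 * B (Φ x).2 := fun x => by
    rw [← hF _ _ (Φ x).2.2]
    exact congrArg (fun y : ({0}ᶜ : Set E) => F y) (Φ.symm_apply_apply x).symm
  have hBr : Measurable fun r : Set.Ioi (0 : ℝ) => B r := hB.comp measurable_subtype_coe
  calc ∫⁻ z, F z ∂μ
      = ∫⁻ x : ({0}ᶜ : Set E), F x ∂(μ.comap Subtype.val) := by
        rw [lintegral_subtype_comap (measurableSet_singleton _).compl, restrict_compl_singleton]
    _ = ∫⁻ q, A q.1 * B q.2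
          ∂(μ.toSphere.prod (Measure.volumeIoiPow (Module.finrank ℝ E - 1))) := by
        simp only [hpolar]
        exact μ.measurePreserving_homeomorphUnitSphereProd.lintegral_comp_emb
          (Homeomorph.measurableEmbedding _) fun q => A q.1 * B q.2
    _ = (∫⁻ ζ, A ζ ∂μ.toSphere) *
          ∫⁻ r : Set.Ioi (0 : ℝ), B r ∂(Measure.volumeIoiPow (Module.finrank ℝ E - 1)) :=
        lintegral_prod_mul (g := fun r : Set.Ioi (0 : ℝ) => B r) hA.aemeasurable hBr.aemeasurable
    _ = _ := by
        rw [Measure.volumeIoiPow, lintegral_withDensity_eq_lintegral_mul _ (by fun_prop) hBr,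
          ← lintegral_subtype_comap measurableSet_Ioi]
        rfl

lemma setLIntegral_ball_one_of_homogeneous {F : E → ℝ≥0∞} {d : ℕ} {W : ℝ → ℝ≥0∞}
    (hW : Measurable W) (hFm : Measurable F)
    (hF : ∀ (r : ℝ) (z : E), 0 < r → F (r • z) = ENNReal.ofReal (r ^ d) * F z) :
    ∫⁻ z in Metric.ball 0 1, W ‖z‖ * F z ∂μ = (∫⁻ ζ, F (ζ : E) ∂μ.toSphere) *
      ∫⁻ r in Set.Ioo (0 : ℝ) 1,
        ENNReal.ofReal (r ^ (Module.finrank ℝ E - 1)) * (W r * ENNReal.ofReal (r ^ d)) := by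
  let B : ℝ → ℝ≥0∞ := (Set.Iio 1).indicator fun r => W r * ENNReal.ofReal (r ^ d)
  rw [← lintegral_indicator measurableSet_ball, lintegral_eq_lintegral_toSphere_mul μ
    (A := fun ζ => F ζ) (B := B) (hFm.comp measurable_subtype_coe)
    ((hW.mul (by fun_prop)).indicator measurableSet_Iio) fun ζ r hr => ?_]
  · simp only [B, ← Set.indicator_mul_right (Set.Iio 1)
      fun r : ℝ => ENNReal.ofReal (r ^ (Module.finrank ℝ E - 1))]
    rw [lintegral_indicator measurableSet_Iio, Measure.restrict_restrict measurableSet_Iio,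
      Set.inter_comm, Set.Ioi_inter_Iio]
  · have hnorm : ‖r • (ζ : E)‖ = r := by
      rw [norm_smul, norm_eq_of_mem_sphere, mul_one, Real.norm_of_nonneg hr.le]
    by_cases hr1 : r < 1
    · simp only [B, Set.indicator_of_mem (show r • (ζ : E) ∈ Metric.ball 0 1 by simpa [hnorm]),
        Set.indicator_of_mem (Set.mem_Iio.2 hr1), hnorm, hF r _ hr]
      ring
    · simp [B, hnorm, hr1]

end Polar

lemma lintegral_rpow_mul_one_sub_rpow {α β : ℝ} (hα : 0 < α) (hβ : 0 < β) :
    ∫⁻ x in Set.Ioo (0 : ℝ) 1, ENNReal.ofReal (x ^ (α - 1) * (1 - x) ^ (β - 1)) =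
      ENNReal.ofReal (ProbabilityTheory.beta α β) := by
  have hbeta := ProbabilityTheory.beta_pos hα hβ
  have hpdf := ProbabilityTheory.lintegral_betaPDF_eq_one hα hβ
  simp only [ProbabilityTheory.lintegral_betaPDF, mul_assoc, one_div,
    ENNReal.ofReal_mul (inv_pos.2 hbeta).le] at hpdf
  rw [lintegral_const_mul' _ _ ENNReal.ofReal_ne_top, ENNReal.ofReal_inv_of_pos hbeta] at hpdf
  rw [← inv_inv (ENNReal.ofReal _)]
  exact ENNReal.eq_inv_of_mul_eq_one_left (by rwa [mul_comm])

lemma lintegral_pow_mul_one_sub_sq_rpow {a : ℕ} (ha : a ≠ 0) {s : ℝ} (hs : -1 < s) :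
    ∫⁻ r in Set.Ioo (0 : ℝ) 1, ENNReal.ofReal (r ^ (2 * a - 1) * (1 - r ^ 2) ^ s) =
      ENNReal.ofReal (ProbabilityTheory.beta a (s + 1) / 2) := by
  obtain ⟨b, rfl⟩ := Nat.exists_eq_succ_of_ne_zero ha
  have himage : (fun r : ℝ => r ^ 2) '' Set.Ioo 0 1 = Set.Ioo 0 1 := by
    ext x
    refine ⟨?_, fun hx => ⟨√x, ⟨Real.sqrt_pos.2 hx.1, ?_⟩, Real.sq_sqrt hx.1.le⟩⟩
    · rintro ⟨r, hr, rfl⟩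
      exact ⟨pow_pos hr.1 2, pow_lt_one₀ hr.1.le hr.2 two_ne_zero⟩
    · rw [Real.sqrt_lt' one_pos, one_pow]
      exact hx.2
  have hinj : Set.InjOn (fun r : ℝ => r ^ 2) (Set.Ioo 0 1) := fun r hr r' hr' h =>
    (pow_left_inj₀ hr.1.le hr'.1.le two_ne_zero).1 h
  have hsubst := lintegral_image_eq_lintegral_abs_deriv_mul measurableSet_Ioo
    (fun r _ => (hasDerivAt_pow 2 r).hasDerivWithinAt) hinj
    fun x => ENNReal.ofReal (x ^ (((b + 1 : ℕ) : ℝ) - 1) * (1 - x) ^ (s + 1 - 1))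
  rw [himage, lintegral_rpow_mul_one_sub_rpow (by positivity) (by linarith)] at hsubst
  rw [div_eq_inv_mul, ENNReal.ofReal_mul (by positivity), hsubst,
    ← lintegral_const_mul' _ _ ENNReal.ofReal_ne_top]
  refine setLIntegral_congr_fun measurableSet_Ioo fun r hr => ?_
  have hr0 := hr.1
  simp only [Nat.cast_add_one, add_sub_cancel_right, Real.rpow_natCast]
  rw [← ENNReal.ofReal_mul (by positivity), ← ENNReal.ofReal_mul (by positivity),
    abs_of_nonneg (by positivity)]
  congr 1
  rw [show 2 * b.succ - 1 = 2 * b + 1 by omega]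
  ring

section Bergman

variable {n : ℕ} {s : ℝ} {f : Cn n → ℂ} {u v : ℕ → Cn n → ℂ}

/-- The density of `bergmanMeasure n s` as a function of the radius. -/
noncomputable def bergmanDensity (n : ℕ) (s r : ℝ) : ℝ≥0∞ :=
  ENNReal.ofReal (Real.Gamma (s + n + 1) / (Real.pi ^ n * Real.Gamma (s + 1)) * (1 - r ^ 2) ^ s)

lemma measurable_bergmanDensity (n : ℕ) (s : ℝ) : Measurable (bergmanDensity n s) := by
  unfold bergmanDensity
  fun_prop

lemma bergmanNormSq_eq_setLIntegral (n : ℕ) (s : ℝ) (f : Cn n → ℂ) :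
    bergmanNormSq n s f = ∫⁻ z in unitBall n, bergmanDensity n s ‖z‖ * ‖f z‖ₑ ^ 2 :=
  lintegral_withDensity_eq_lintegral_mul_non_measurable _
    ((measurable_bergmanDensity n s).comp measurable_norm)
    (Eventually.of_forall fun _ => ENNReal.ofReal_lt_top) _

lemma setLIntegral_unitBall_circle_smul (c : Circle) (F : Cn n → ℝ≥0∞) :
    ∫⁻ z in unitBall n, F ((c : ℂ) • z) = ∫⁻ z in unitBall n, F z := by
  let rotation : Cn n ≃ₗᵢ[ℝ] Cn n := LinearIsometry.toLinearIsometryEquiv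
    ⟨Algebra.lsmul ℝ ℝ (Cn n) (c : ℂ), fun z => by
      rw [Algebra.lsmul_coe, norm_smul, Circle.norm_coe, one_mul]⟩ rfl
  have hball : rotation ⁻¹' unitBall n = unitBall n := by
    ext z
    simp
  have hrotation := rotation.measurePreserving.setLIntegral_comp_preimage_emb
    rotation.toHomeomorph.measurableEmbedding F (unitBall n)
  rwa [hball] at hrotation

lemma bergmanNormSq_eq_setLIntegral_circleSlice (n : ℕ) (s : ℝ) (f : Cn n → ℂ)
    (t : UnitAddCircle) : bergmanNormSq n s f =
      ∫⁻ z in unitBall n, bergmanDensity n s ‖z‖ * ‖circleSlice f z t‖ₑ ^ 2 := by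
  rw [bergmanNormSq_eq_setLIntegral, ← setLIntegral_unitBall_circle_smul (AddCircle.toCircle t)]
  simp only [norm_smul, Circle.norm_coe, one_mul, circleSlice]

lemma aemeasurable_circleSlice (hf : ContinuousOn f (unitBall n)) :
    AEMeasurable (fun q : UnitAddCircle × Cn n => circleSlice f q.2 q.1)
      (AddCircle.haarAddCircle.prod (volume.restrict (unitBall n))) := by
  have hcont : ContinuousOn (fun q : UnitAddCircle × Cn n => circleSlice f q.2 q.1)
      (Set.univ ×ˢ unitBall n) :=
    hf.comp continuous_toCircle_smul.continuousOn fun q hq =>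
      (circle_smul_mem_unitBall_iff _).2 hq.2
  rw [← Measure.restrict_univ (μ := AddCircle.haarAddCircle), Measure.prod_restrict]
  exact hcont.aemeasurable (MeasurableSet.univ.prod measurableSet_ball)

lemma continuous_of_mem_solidHol {p : ℕ} {u : Cn n → ℂ} (hu : u ∈ solidHol n p) :
    Continuous u := by
  obtain ⟨P, -, hu⟩ := hu
  rw [funext hu]
  exact (MvPolynomial.continuous_eval P).comp (PiLp.continuous_ofLp 2 _)

lemma continuous_of_mem_solidAnti {q : ℕ} {v : Cn n → ℂ} (hv : v ∈ solidAnti n q) :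
    Continuous v := by
  obtain ⟨P, -, hv⟩ := hv
  rw [funext hv]
  exact (MvPolynomial.continuous_eval P).comp (by fun_prop)

lemma IsPeterWeyl.lintegral_bergmanDensity_circleSlice (H : IsPeterWeyl n f u v) (s : ℝ) {z : Cn n}
    (hz : z ∈ unitBall n) :
    ∫⁻ t, bergmanDensity n s ‖z‖ * ‖circleSlice f z t‖ₑ ^ 2 ∂AddCircle.haarAddCircle =
      ∑' p, (bergmanDensity n s ‖z‖ * ‖u p z‖ₑ ^ 2 + bergmanDensity n s ‖z‖ * ‖v p z‖ₑ ^ 2) := by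
  have hfinite : bergmanDensity n s ‖z‖ ≠ ⊤ := ENNReal.ofReal_ne_top
  rw [lintegral_const_mul' _ _ hfinite, H.lintegral_circleSlice hz, ← ENNReal.tsum_mul_left]
  simp only [mul_add]

/-- Averaging over the rotations `z ↦ e^{2πit} z` and exchanging the two integrals reduces the
claim to Parseval's identity on circles. -/
lemma IsPeterWeyl.bergmanNormSq_eq_tsum_setLIntegral (H : IsPeterWeyl n f u v)
    (hf : ContinuousOn f (unitBall n)) (s : ℝ) :
    bergmanNormSq n s f =
      ∑' p, ((∫⁻ z in unitBall n, bergmanDensity n s ‖z‖ * ‖u p z‖ₑ ^ 2) +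
        ∫⁻ z in unitBall n, bergmanDensity n s ‖z‖ * ‖v p z‖ₑ ^ 2) := by
  have hW : Measurable fun z : Cn n => bergmanDensity n s ‖z‖ :=
    (measurable_bergmanDensity n s).comp measurable_norm
  have hu : ∀ p, Measurable fun z => bergmanDensity n s ‖z‖ * ‖u p z‖ₑ ^ 2 := fun p =>
    hW.mul ((continuous_of_mem_solidHol (H.hol p)).measurable.enorm.pow_const 2)
  have hv : ∀ p, Measurable fun z => bergmanDensity n s ‖z‖ * ‖v p z‖ₑ ^ 2 := fun p =>
    hW.mul ((continuous_of_mem_solidAnti (H.anti p)).measurable.enorm.pow_const 2)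
  have hswap : AEMeasurable
      (fun q : UnitAddCircle × Cn n => bergmanDensity n s ‖q.2‖ * ‖circleSlice f q.2 q.1‖ₑ ^ 2)
      (AddCircle.haarAddCircle.prod (volume.restrict (unitBall n))) :=
    (hW.comp measurable_snd).aemeasurable.mul ((aemeasurable_circleSlice hf).enorm.pow_const 2)
  calc bergmanNormSq n s f
      = ∫⁻ t : UnitAddCircle, (∫⁻ z in unitBall n,
          bergmanDensity n s ‖z‖ * ‖circleSlice f z t‖ₑ ^ 2) ∂AddCircle.haarAddCircle := by
        simp only [← bergmanNormSq_eq_setLIntegral_circleSlice, lintegral_const, measure_univ,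
          mul_one]
    _ = ∫⁻ z in unitBall n, ∫⁻ t : UnitAddCircle,
          bergmanDensity n s ‖z‖ * ‖circleSlice f z t‖ₑ ^ 2 ∂AddCircle.haarAddCircle :=
        lintegral_lintegral_swap hswap
    _ = ∫⁻ z in unitBall n, ∑' p,
          (bergmanDensity n s ‖z‖ * ‖u p z‖ₑ ^ 2 + bergmanDensity n s ‖z‖ * ‖v p z‖ₑ ^ 2) :=
        setLIntegral_congr_fun measurableSet_ball fun _ hz =>
          H.lintegral_bergmanDensity_circleSlice s hz
    _ = _ := by
        simp only [← lintegral_add_left (hu _)]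
        exact lintegral_tsum fun p => ((hu p).add (hv p)).aemeasurable

/-- The moment `∫ ‖z‖ ^ (2 p) dμ_s(z)` of the Bergman measure, i.e. the ratio between the squared
norms in `L²(dμ_s)` and in `L²(dσ)` of a function homogeneous of degree `p`. -/
noncomputable def bergmanMoment (n : ℕ) (s : ℝ) (p : ℕ) : ℝ :=
  Real.Gamma (n + p) * Real.Gamma (n + s + 1) / (Real.Gamma n * Real.Gamma (n + p + s + 1))

lemma finrank_real_Cn (n : ℕ) : Module.finrank ℝ (Cn n) = 2 * n := by
  rw [finrank_real_of_complex, finrank_euclideanSpace, Fintype.card_fin]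

lemma toSphere_univ_Cn (hn : n ≠ 0) : (volume : Measure (Cn n)).toSphere Set.univ =
    ENNReal.ofReal (2 * Real.pi ^ n / Real.Gamma n) := by
  obtain ⟨N, rfl⟩ := Nat.exists_eq_succ_of_ne_zero hn
  rw [Measure.toSphere_apply_univ, InnerProductSpace.volume_ball_of_dim_even (finrank_real_Cn _),
    finrank_real_Cn, ENNReal.ofReal_one, one_pow, one_mul, ← ENNReal.ofReal_natCast,
    ← ENNReal.ofReal_mul (by positivity), Nat.cast_succ, Real.Gamma_nat_eq_factorial,
    Nat.factorial_succ]
  congr 1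
  push_cast
  field_simp

lemma toSphere_univ_mul_sphereNormSq (hn : n ≠ 0) (g : Cn n → ℂ) :
    (volume : Measure (Cn n)).toSphere Set.univ * sphereNormSq n g =
      ∫⁻ ζ, ‖g ζ‖ₑ ^ 2 ∂(volume : Measure (Cn n)).toSphere := by
  have : NeZero n := ⟨hn⟩
  rw [sphereNormSq, sphereMeasure, lintegral_smul_measure, smul_eq_mul, ← mul_assoc,
    ENNReal.mul_inv_cancel _ (measure_ne_top _ _), one_mul]
  rw [Ne, Measure.measure_univ_eq_zero]
  exact Measure.toSphere_ne_zero _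

lemma lintegral_radial_bergmanDensity (hn : n ≠ 0) (hs : -1 < s) (p : ℕ) :
    ∫⁻ r in Set.Ioo (0 : ℝ) 1, ENNReal.ofReal (r ^ (2 * n - 1)) *
        (bergmanDensity n s r * ENNReal.ofReal (r ^ (2 * p))) =
      ENNReal.ofReal (Real.Gamma n / (2 * Real.pi ^ n) * bergmanMoment n s p) := by
  set K := Real.Gamma (s + n + 1) / (Real.pi ^ n * Real.Gamma (s + 1)) with hK
  have hΓ : 0 < Real.Gamma (s + 1) := Real.Gamma_pos_of_pos (by linarith)
  have hK0 : 0 ≤ K := div_nonneg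
    (Real.Gamma_nonneg_of_nonneg (by linarith [Nat.cast_nonneg (α := ℝ) n])) (by positivity)
  have hintegrand : ∀ r ∈ Set.Ioo (0 : ℝ) 1, ENNReal.ofReal (r ^ (2 * n - 1)) *
      (bergmanDensity n s r * ENNReal.ofReal (r ^ (2 * p))) =
      ENNReal.ofReal K * ENNReal.ofReal (r ^ (2 * (n + p) - 1) * (1 - r ^ 2) ^ s) := by
    intro r hr
    have hr0 := hr.1
    have hr1 : 0 ≤ 1 - r ^ 2 := by nlinarith [hr.1, hr.2]
    rw [bergmanDensity, ← hK, ← ENNReal.ofReal_mul (by positivity),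
      ← ENNReal.ofReal_mul (by positivity), ← ENNReal.ofReal_mul hK0,
      show 2 * (n + p) - 1 = (2 * n - 1) + 2 * p by omega]
    congr 1
    ring
  rw [setLIntegral_congr_fun measurableSet_Ioo hintegrand,
    lintegral_const_mul' _ _ ENNReal.ofReal_ne_top,
    lintegral_pow_mul_one_sub_sq_rpow (by omega) hs, ← ENNReal.ofReal_mul hK0]
  have hΓn : Real.Gamma n ≠ 0 := (Real.Gamma_pos_of_pos (by positivity)).ne'
  congr 1
  rw [hK, ProbabilityTheory.beta, bergmanMoment]
  push_cast
  field_simp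
  ring_nf

lemma setLIntegral_bergmanDensity_of_homogeneous (hn : n ≠ 0) (hs : -1 < s) {p : ℕ}
    {g : Cn n → ℂ} (hgc : Continuous g)
    (hg : ∀ (r : ℝ) (z : Cn n), 0 < r → ‖g (r • z)‖ = r ^ p * ‖g z‖) :
    ∫⁻ z in unitBall n, bergmanDensity n s ‖z‖ * ‖g z‖ₑ ^ 2 =
      ENNReal.ofReal (bergmanMoment n s p) * sphereNormSq n g := by
  have : NeZero n := ⟨hn⟩
  have : 0 < Real.Gamma n := Real.Gamma_pos_of_pos (by positivity)
  rw [setLIntegral_ball_one_of_homogeneous volume (d := 2 * p) (measurable_bergmanDensity n s)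
      (hgc.measurable.enorm.pow_const 2) fun r z hr => ?_,
    finrank_real_Cn, lintegral_radial_bergmanDensity hn hs,
    ← toSphere_univ_mul_sphereNormSq hn, mul_right_comm, toSphere_univ_Cn hn,
    ← ENNReal.ofReal_mul (by positivity)]
  · congr 2
    field_simp
  · rw [← ofReal_norm, hg r z hr, ENNReal.ofReal_mul (by positivity), ofReal_norm, mul_pow,
      ← ENNReal.ofReal_pow (by positivity), ← pow_mul, mul_comm p]

lemma IsPeterWeyl.bergmanNormSq_eq_tsum (H : IsPeterWeyl n f u v)
    (hf : ContinuousOn f (unitBall n)) (hn : n ≠ 0) (hs : -1 < s) :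
    bergmanNormSq n s f = ∑' p, ENNReal.ofReal (bergmanMoment n s p) *
      (sphereNormSq n (u p) + sphereNormSq n (v p)) := by
  have hu : ∀ p (r : ℝ) z, 0 < r → ‖u p (r • z)‖ = r ^ p * ‖u p z‖ := fun p r z hr => by
    rw [← Complex.coe_smul, apply_smul_of_mem_solidHol (H.hol p)]
    simp [abs_of_pos hr]
  have hv : ∀ p (r : ℝ) z, 0 < r → ‖v p (r • z)‖ = r ^ p * ‖v p z‖ := fun p r z hr => by
    rw [← Complex.coe_smul, apply_smul_of_mem_solidAnti (H.anti p)]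
    simp [abs_of_pos hr]
  rw [H.bergmanNormSq_eq_tsum_setLIntegral hf]
  refine tsum_congr fun p => ?_
  rw [setLIntegral_bergmanDensity_of_homogeneous hn hs (continuous_of_mem_solidHol (H.hol p))
      (hu p), setLIntegral_bergmanDensity_of_homogeneous hn hs
      (continuous_of_mem_solidAnti (H.anti p)) (hv p), mul_add]

end Bergman

section EnergyWeight

/-- The weight of the degree `p` components in `dirichletNormSq`. -/
noncomputable def dirichletWeight (n p : ℕ) : ℝ :=
  (p : ℝ) * (n.ascFactorial p : ℝ) / (p ! : ℝ)

/-- The weight of the degree `p` components in `radialEnergy`. -/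
noncomputable def energyWeight (n m p : ℕ) : ℝ :=
  (p : ℝ) ^ (2 * m) * bergmanMoment n (2 * m - n - 1) p

lemma Gamma_mul_ascFactorial {n : ℕ} (hn : n ≠ 0) (p : ℕ) :
    Real.Gamma n * n.ascFactorial p = Real.Gamma (n + p) := by
  obtain ⟨N, rfl⟩ := Nat.exists_eq_succ_of_ne_zero hn
  rw [Nat.cast_succ, Real.Gamma_nat_eq_factorial, show (N : ℝ) + 1 + p = (N + p : ℕ) + 1 by
    push_cast; ring, Real.Gamma_nat_eq_factorial, ← Nat.factorial_mul_ascFactorial, Nat.cast_mul]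

lemma energyWeight_eq {n m : ℕ} (hn : n ≠ 0) (hm : m ≠ 0) (p : ℕ) :
    energyWeight n m p = dirichletWeight n p *
      ((2 * m - 1)! * ((p ! : ℝ) * p ^ (2 * m - 1) / (p + (2 * m - 1))!)) := by
  have : NeZero n := ⟨hn⟩
  have hΓ : Real.Gamma n ≠ 0 := (Real.Gamma_pos_of_pos (by positivity)).ne'
  obtain ⟨M, hM⟩ : ∃ M, 2 * m = M + 1 := ⟨2 * m - 1, by omega⟩
  have hM' : (2 * m : ℝ) = M + 1 := by exact_mod_cast hM
  rw [energyWeight, dirichletWeight, bergmanMoment, hM, hM', Nat.add_sub_cancel,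
    ← Gamma_mul_ascFactorial hn, show (n : ℝ) + (M + 1 - n - 1) + 1 = M + 1 by ring,
    show (n : ℝ) + p + (M + 1 - n - 1) + 1 = (p + M : ℕ) + 1 by push_cast; ring,
    Real.Gamma_nat_eq_factorial, Real.Gamma_nat_eq_factorial]
  field_simp
  ring

lemma factorial_mul_pow_div_factorial_le_one (p M : ℕ) :
    (p ! : ℝ) * p ^ M / (p + M)! ≤ 1 := by
  rw [div_le_one (by positivity)]
  exact_mod_cast (Nat.mul_le_mul_left _ (Nat.pow_le_pow_left p.le_succ M)).trans
    Nat.factorial_mul_pow_le_factorial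

lemma inv_pow_le_factorial_mul_pow_div_factorial {p : ℕ} (hp : p ≠ 0) (M : ℕ) :
    ((M + 1 : ℝ) ^ M)⁻¹ ≤ (p ! : ℝ) * p ^ M / (p + M)! := by
  have hfactorial : (p + M)! ≤ (M + 1) ^ M * (p ! * p ^ M) := by
    calc (p + M)! = p ! * (p + 1).ascFactorial M := (Nat.factorial_mul_ascFactorial p M).symm
      _ ≤ p ! * ((M + 1) * p) ^ M := by
        gcongr
        refine (Nat.ascFactorial_le_pow_add p M).trans (Nat.pow_le_pow_left ?_ M)
        nlinarith [Nat.pos_of_ne_zero hp]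
      _ = (M + 1) ^ M * (p ! * p ^ M) := by rw [mul_pow]; ring
  rw [inv_le_iff_one_le_mul₀ (by positivity), div_mul_eq_mul_div, one_le_div (by positivity)]
  rw [mul_comm]
  exact_mod_cast hfactorial

lemma dirichletWeight_nonneg (n p : ℕ) : 0 ≤ dirichletWeight n p := by
  unfold dirichletWeight
  positivity

lemma exists_energyWeight_comparison {n m : ℕ} (hn : n ≠ 0) (hm : m ≠ 0) :
    ∃ c C : ℝ, 0 < c ∧ 0 < C ∧ ∀ p,
      c * dirichletWeight n p ≤ energyWeight n m p ∧
      energyWeight n m p ≤ C * dirichletWeight n p := by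
  set M := 2 * m - 1
  refine ⟨M ! * ((M + 1 : ℝ) ^ M)⁻¹, M !, by positivity, by positivity, fun p => ?_⟩
  rw [energyWeight_eq hn hm, mul_comm _ (dirichletWeight n p), mul_comm _ (dirichletWeight n p)]
  refine ⟨?_, mul_le_mul_of_nonneg_left ?_ (dirichletWeight_nonneg n p)⟩
  · obtain rfl | hp := eq_or_ne p 0
    · simp [dirichletWeight]
    · have := dirichletWeight_nonneg n p
      gcongr
      exact inv_pow_le_factorial_mul_pow_div_factorial hp M
  · exact mul_le_of_le_one_right (by positivity) (factorial_mul_pow_div_factorial_le_one p M)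

end EnergyWeight

section SquaredSeminorm

variable {𝕜 W : Type*} [NormedField 𝕜] [AddCommGroup W] [Module 𝕜 W]

/-- `q` is the square of an extended-real-valued seminorm on the subspace `S`. The triangle
inequality is encoded through `(a + b)² = inf_{t > 0} ((1 + t) a² + (1 + t⁻¹) b²)`, since this form
passes directly through sums and integrals. -/
structure IsSquaredSeminormOn (S : Submodule 𝕜 W) (q : W → ℝ≥0∞) : Prop where
  smul : ∀ (c : 𝕜), ∀ x ∈ S, q (c • x) = ‖c‖ₑ ^ 2 * q x
  add_le : ∀ x ∈ S, ∀ y ∈ S, ∀ t : ℝ, 0 < t →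
    q (x + y) ≤ ENNReal.ofReal (1 + t) * q x + ENNReal.ofReal (1 + t⁻¹) * q y

lemma sqrt_le_sqrt_add_sqrt_of_forall {A B C : ℝ}
    (h : ∀ t > 0, C ≤ (1 + t) * A + (1 + t⁻¹) * B) : √C ≤ √A + √B := by
  refine le_of_forall_pos_le_add fun ε hε => Real.sqrt_le_iff.2 ⟨by positivity, ?_⟩
  set a := √A + ε / 2 with ha
  set b := √B + ε / 2 with hb
  have ha0 : 0 < a := by positivity
  have hb0 : 0 < b := by positivity
  have hA : A ≤ a ^ 2 := (Real.sqrt_le_left ha0.le).1 (by linarith)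
  have hB : B ≤ b ^ 2 := (Real.sqrt_le_left hb0.le).1 (by linarith)
  calc C ≤ (1 + b / a) * A + (1 + (b / a)⁻¹) * B := h _ (by positivity)
    _ ≤ (1 + b / a) * a ^ 2 + (1 + (b / a)⁻¹) * b ^ 2 := by gcongr
    _ = (a + b) ^ 2 := by field_simp; ring
    _ = (√A + √B + ε) ^ 2 := by rw [ha, hb]; ring

lemma sqrt_mul_sqrt_toReal_le {c : ℝ} {x y : ℝ≥0∞} (hc : 0 ≤ c) (hy : y ≠ ⊤)
    (h : ENNReal.ofReal c * x ≤ y) : √c * √x.toReal ≤ √y.toReal := by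
  rw [← Real.sqrt_mul hc, ← ENNReal.toReal_ofReal_mul _ _ hc]
  exact Real.sqrt_le_sqrt (ENNReal.toReal_mono hy h)

lemma sqrt_toReal_le_sqrt_mul {C : ℝ} {x y : ℝ≥0∞} (hC : 0 ≤ C) (hx : x ≠ ⊤)
    (h : y ≤ ENNReal.ofReal C * x) : √y.toReal ≤ √C * √x.toReal := by
  rw [← Real.sqrt_mul hC, ← ENNReal.toReal_ofReal_mul _ _ hC]
  exact Real.sqrt_le_sqrt (ENNReal.toReal_mono (by finiteness) h)

variable {S V : Submodule 𝕜 W} {q : W → ℝ≥0∞}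

/-- The subspace of `S` on which the squared seminorm `q` is finite. -/
def IsSquaredSeminormOn.finiteSubmodule (hq : IsSquaredSeminormOn S q) : Submodule 𝕜 W where
  carrier := {x | x ∈ S ∧ q x < ⊤}
  zero_mem' := by
    have hzero : q 0 = 0 := by simpa using hq.smul 0 0 S.zero_mem
    exact ⟨S.zero_mem, hzero.trans_lt ENNReal.zero_lt_top⟩
  add_mem' := by
    rintro x y ⟨hx, hqx⟩ ⟨hy, hqy⟩
    exact ⟨S.add_mem hx hy, (hq.add_le x hx y hy 1 one_pos).trans_lt (by finiteness)⟩
  smul_mem' := by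
    rintro c x ⟨hx, hqx⟩
    exact ⟨S.smul_mem c hx, by rw [hq.smul c x hx]; finiteness⟩

lemma IsSquaredSeminormOn.exists_seminorm (hq : IsSquaredSeminormOn S q) (hVS : V ≤ S)
    (hfin : ∀ x ∈ V, q x ≠ ⊤) : ∃ D : Seminorm 𝕜 V, ∀ x : V, D x = √(q x).toReal := by
  refine ⟨Seminorm.of (fun x : V => √(q x).toReal) (fun x y => ?_) (fun c x => ?_), fun x => rfl⟩
  · refine sqrt_le_sqrt_add_sqrt_of_forall fun t ht => ?_
    have hx := hfin x x.2
    have hy := hfin y y.2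
    have hle := ENNReal.toReal_mono (by finiteness) (hq.add_le x (hVS x.2) y (hVS y.2) t ht)
    rwa [ENNReal.toReal_add (by finiteness) (by finiteness),
      ENNReal.toReal_ofReal_mul _ _ (by positivity),
      ENNReal.toReal_ofReal_mul _ _ (by positivity)] at hle
  · rw [Submodule.coe_smul, hq.smul c x (hVS x.2), ENNReal.toReal_mul, ENNReal.toReal_pow,
      toReal_enorm, Real.sqrt_mul (by positivity), Real.sqrt_sq (norm_nonneg _)]

end SquaredSeminorm

section WeightedNorm

variable {n : ℕ} {f f' : Cn n → ℂ} {u u' v v' : ℕ → Cn n → ℂ}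

lemma IsPeterWeyl.add (H : IsPeterWeyl n f u v) (H' : IsPeterWeyl n f' u' v') :
    IsPeterWeyl n (f + f') (u + u') (v + v') where
  hol p := by
    obtain ⟨P, hP, hu⟩ := H.hol p
    obtain ⟨Q, hQ, hu'⟩ := H'.hol p
    exact ⟨P + Q, hP.add hQ, fun z => by simp [hu, hu']⟩
  anti p := by
    obtain ⟨P, hP, hv⟩ := H.anti p
    obtain ⟨Q, hQ, hv'⟩ := H'.anti p
    exact ⟨P + Q, hP.add hQ, fun z => by simp [hv, hv']⟩
  anti_zero := by simp [H.anti_zero, H'.anti_zero]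
  tendsto := by
    refine (H.tendsto.add H'.tendsto).congr fun N z _ => ?_
    simp only [Pi.add_apply, ← Finset.sum_add_distrib]
    exact Finset.sum_congr rfl fun _ _ => by ring

lemma IsPeterWeyl.const_smul (H : IsPeterWeyl n f u v) (c : ℂ) :
    IsPeterWeyl n (c • f) (c • u) (c • v) where
  hol p := by
    obtain ⟨P, hP, hu⟩ := H.hol p
    exact ⟨MvPolynomial.C c * P, by simpa using (MvPolynomial.isHomogeneous_C _ _).mul hP,
      fun z => by simp [hu]⟩
  anti p := by
    obtain ⟨P, hP, hv⟩ := H.anti p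
    exact ⟨MvPolynomial.C c * P, by simpa using (MvPolynomial.isHomogeneous_C _ _).mul hP,
      fun z => by simp [hv]⟩
  anti_zero := by simp [H.anti_zero]
  tendsto := by
    refine ((uniformContinuous_const_smul (M := ℂ) (X := ℂ) c).comp_tendstoLocallyUniformlyOn
      H.tendsto).congr fun N z _ => ?_
    simp [mul_add, Finset.mul_sum]

lemma enorm_add_sq_le {E : Type*} [SeminormedAddCommGroup E] (x y : E) {t : ℝ} (ht : 0 < t) :
    ‖x + y‖ₑ ^ 2 ≤ ENNReal.ofReal (1 + t) * ‖x‖ₑ ^ 2 + ENNReal.ofReal (1 + t⁻¹) * ‖y‖ₑ ^ 2 := by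
  simp only [← ofReal_norm, ← ENNReal.ofReal_pow (norm_nonneg _)]
  rw [← ENNReal.ofReal_mul (by positivity), ← ENNReal.ofReal_mul (by positivity),
    ← ENNReal.ofReal_add (by positivity) (by positivity)]
  refine ENNReal.ofReal_le_ofReal ?_
  have hAMGM : 0 ≤ t⁻¹ * (t * ‖x‖ - ‖y‖) ^ 2 := by positivity
  calc ‖x + y‖ ^ 2 ≤ (‖x‖ + ‖y‖) ^ 2 := by gcongr; exact norm_add_le x y
    _ = (1 + t) * ‖x‖ ^ 2 + (1 + t⁻¹) * ‖y‖ ^ 2 - t⁻¹ * (t * ‖x‖ - ‖y‖) ^ 2 := by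
      field_simp
      ring
    _ ≤ (1 + t) * ‖x‖ ^ 2 + (1 + t⁻¹) * ‖y‖ ^ 2 := sub_le_self _ hAMGM

lemma sphereNormSq_const_smul (c : ℂ) (g : Cn n → ℂ) :
    sphereNormSq n (c • g) = ‖c‖ₑ ^ 2 * sphereNormSq n g := by
  simp only [sphereNormSq, Pi.smul_apply, enorm_smul, mul_pow]
  exact lintegral_const_mul' _ _ (by finiteness)

lemma sphereNormSq_add_le {g g' : Cn n → ℂ} (hg : Continuous g) {t : ℝ} (ht : 0 < t) :
    sphereNormSq n (g + g') ≤ ENNReal.ofReal (1 + t) * sphereNormSq n g +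
      ENNReal.ofReal (1 + t⁻¹) * sphereNormSq n g' := by
  simp only [sphereNormSq]
  rw [← lintegral_const_mul' _ _ ENNReal.ofReal_ne_top,
    ← lintegral_const_mul' _ _ ENNReal.ofReal_ne_top, ← lintegral_add_left]
  · exact lintegral_mono fun z => enorm_add_sq_le _ _ ht
  · exact ((hg.comp continuous_subtype_val).measurable.enorm.pow_const 2).const_mul _

/-- The weighted sum `∑ a_p (‖u_p‖² + ‖v_p‖²)` of squared norms in `L²(dσ)`. Both `dirichletNormSq`
and `radialEnergy` are of this form in terms of the Peter–Weyl components. -/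
noncomputable def weightedNormSq (n : ℕ) (a : ℕ → ℝ) (u v : ℕ → Cn n → ℂ) : ℝ≥0∞ :=
  ∑' p, ENNReal.ofReal (a p) * (sphereNormSq n (u p) + sphereNormSq n (v p))

lemma weightedNormSq_const_smul (a : ℕ → ℝ) (c : ℂ) (u v : ℕ → Cn n → ℂ) :
    weightedNormSq n a (c • u) (c • v) = ‖c‖ₑ ^ 2 * weightedNormSq n a u v := by
  simp only [weightedNormSq, Pi.smul_apply c, sphereNormSq_const_smul]
  rw [← ENNReal.tsum_mul_left]
  exact tsum_congr fun p => by ring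

lemma weightedNormSq_add_le (a : ℕ → ℝ) (hu : ∀ p, Continuous (u p)) (hv : ∀ p, Continuous (v p))
    {t : ℝ} (ht : 0 < t) :
    weightedNormSq n a (u + u') (v + v') ≤ ENNReal.ofReal (1 + t) * weightedNormSq n a u v +
      ENNReal.ofReal (1 + t⁻¹) * weightedNormSq n a u' v' := by
  simp only [weightedNormSq]
  rw [← ENNReal.tsum_mul_left, ← ENNReal.tsum_mul_left, ← ENNReal.tsum_add]
  refine ENNReal.tsum_le_tsum fun p => ?_
  calc _ ≤ ENNReal.ofReal (a p) * ((ENNReal.ofReal (1 + t) * sphereNormSq n (u p) +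
        ENNReal.ofReal (1 + t⁻¹) * sphereNormSq n (u' p)) +
        (ENNReal.ofReal (1 + t) * sphereNormSq n (v p) +
        ENNReal.ofReal (1 + t⁻¹) * sphereNormSq n (v' p))) := by
        gcongr
        · exact sphereNormSq_add_le (hu p) ht
        · exact sphereNormSq_add_le (hv p) ht
    _ = _ := by ring

lemma weightedNormSq_mono {a b : ℕ → ℝ} (hab : a ≤ b) (u v : ℕ → Cn n → ℂ) :
    weightedNormSq n a u v ≤ weightedNormSq n b u v :=
  ENNReal.tsum_le_tsum fun p => by
    gcongr
    exact hab p

lemma weightedNormSq_const_mul {c : ℝ} (hc : 0 ≤ c) (a : ℕ → ℝ) (u v : ℕ → Cn n → ℂ) :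
    weightedNormSq n (fun p => c * a p) u v = ENNReal.ofReal c * weightedNormSq n a u v := by
  simp only [weightedNormSq, ENNReal.ofReal_mul hc, mul_assoc, ENNReal.tsum_mul_left]

lemma IsPeterWeyl.dirichletNormSq_eq (H : IsPeterWeyl n f u v) :
    dirichletNormSq n f = weightedNormSq n (dirichletWeight n) u v := by
  refine le_antisymm (iInf_le_of_le u (iInf_le_of_le v (iInf_le_of_le H le_rfl))) ?_
  refine le_iInf fun u' => le_iInf fun v' => le_iInf fun H' => ?_
  obtain ⟨rfl, rfl⟩ := H.unique H'
  exact le_rfl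

lemma IsPeterWeyl.radialEnergy_eq (H : IsPeterWeyl n f u v) (hf : IsPluriharmonic n f)
    (hn : n ≠ 0) {m : ℕ} (hm : (n : ℝ) / 2 < m) :
    radialEnergy n m f = weightedNormSq n (energyWeight n m) u v := by
  obtain ⟨h, k, Hf⟩ := hf.exists_isHolAddConj
  obtain ⟨rfl, rfl⟩ := H.unique Hf.isPeterWeyl
  have Hm := Hf.iterate_radialDeriv m
  have hU : IsOpen (unitBall n) := Metric.isOpen_ball
  have h0 : (0 : Cn n) ∈ unitBall n := Metric.mem_ball_self one_pos
  rw [radialEnergy, Hm.isPeterWeyl.bergmanNormSq_eq_tsum Hm.continuousOn hn (by linarith),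
    weightedNormSq]
  refine tsum_congr fun p => ?_
  have hhol : taylorComponent (eulerDeriv^[m] h) p = (p : ℂ) ^ m • taylorComponent h p :=
    funext (taylorComponent_iterate_eulerDeriv hU h0 Hf.hol m p)
  have hanti : (fun z => conj (taylorComponent (eulerDeriv^[m] k) p z)) =
      (p : ℂ) ^ m • fun z => conj (taylorComponent k p z) :=
    funext fun z => by simp [taylorComponent_iterate_eulerDeriv hU h0 Hf.hol_conj m p z]
  have hfactor : ‖(p : ℂ) ^ m‖ₑ ^ 2 = ENNReal.ofReal ((p : ℝ) ^ (2 * m)) := by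
    rw [← ofReal_norm, ← ENNReal.ofReal_pow (norm_nonneg _), norm_pow, Complex.norm_natCast,
      ← pow_mul, mul_comm]
  rw [hhol, hanti, sphereNormSq_const_smul, sphereNormSq_const_smul, hfactor, energyWeight,
    ENNReal.ofReal_mul (by positivity)]
  ring

end WeightedNorm

section Dirichlet

variable {n : ℕ} {f g : Cn n → ℂ}

lemma wirtinger_congr {j : Fin n} {z : Cn n} (h : f =ᶠ[𝓝 z] g) :
    wirtinger n j f z = wirtinger n j g z := by
  rw [wirtinger, wirtinger, h.fderiv_eq]

lemma wirtinger_add {j : Fin n} {z : Cn n} (hf : DifferentiableAt ℝ f z)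
    (hg : DifferentiableAt ℝ g z) :
    wirtinger n j (f + g) z = wirtinger n j f z + wirtinger n j g z := by
  simp only [wirtinger, fderiv_add hf hg, add_apply]
  ring

lemma wirtingerBar_add {j : Fin n} {z : Cn n} (hf : DifferentiableAt ℝ f z)
    (hg : DifferentiableAt ℝ g z) :
    wirtingerBar n j (f + g) z = wirtingerBar n j f z + wirtingerBar n j g z := by
  simp only [wirtingerBar, fderiv_add hf hg, add_apply]
  ring

lemma wirtinger_const_smul {j : Fin n} {z : Cn n} (hf : DifferentiableAt ℝ f z) (c : ℂ) :
    wirtinger n j (c • f) z = c * wirtinger n j f z := by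
  simp only [wirtinger, fderiv_const_smul hf, smul_apply, smul_eq_mul]
  ring

lemma wirtingerBar_const_smul {j : Fin n} {z : Cn n} (hf : DifferentiableAt ℝ f z) (c : ℂ) :
    wirtingerBar n j (c • f) z = c * wirtingerBar n j f z := by
  simp only [wirtingerBar, fderiv_const_smul hf, smul_apply, smul_eq_mul]
  ring

lemma IsPluriharmonic.differentiableAt (hf : IsPluriharmonic n f) {z : Cn n}
    (hz : z ∈ unitBall n) : DifferentiableAt ℝ f z :=
  (hf.1.contDiffAt (Metric.isOpen_ball.mem_nhds hz)).differentiableAt two_ne_zero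

lemma IsPluriharmonic.differentiableAt_wirtingerBar (hf : IsPluriharmonic n f) {z : Cn n}
    (hz : z ∈ unitBall n) (k : Fin n) : DifferentiableAt ℝ (wirtingerBar n k f) z := by
  have hfderiv : DifferentiableAt ℝ (fderiv ℝ f) z :=
    ((hf.1.contDiffAt (Metric.isOpen_ball.mem_nhds hz)).fderiv_right (m := 1)
      (by norm_num)).differentiableAt one_ne_zero
  have happly : ∀ v, DifferentiableAt ℝ (fun z => fderiv ℝ f z v) z := fun v =>
    hfderiv.clm_apply (differentiableAt_const v)
  exact ((happly _).add ((happly _).const_mul Complex.I)).mul_const (2 : ℂ)⁻¹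

lemma IsPluriharmonic.add (hf : IsPluriharmonic n f) (hg : IsPluriharmonic n g) :
    IsPluriharmonic n (f + g) := by
  refine ⟨hf.1.add hg.1, fun z hz j k => ?_⟩
  have hbar : wirtingerBar n k (f + g) =ᶠ[𝓝 z] wirtingerBar n k f + wirtingerBar n k g := by
    filter_upwards [Metric.isOpen_ball.mem_nhds hz] with w hw
    exact wirtingerBar_add (hf.differentiableAt hw) (hg.differentiableAt hw)
  rw [wirtinger_congr hbar, wirtinger_add (hf.differentiableAt_wirtingerBar hz k)
    (hg.differentiableAt_wirtingerBar hz k), hf.2 z hz, hg.2 z hz, add_zero]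

lemma IsPluriharmonic.const_smul (hf : IsPluriharmonic n f) (c : ℂ) :
    IsPluriharmonic n (c • f) := by
  refine ⟨hf.1.const_smul c, fun z hz j k => ?_⟩
  have hbar : wirtingerBar n k (c • f) =ᶠ[𝓝 z] c • wirtingerBar n k f := by
    filter_upwards [Metric.isOpen_ball.mem_nhds hz] with w hw
    exact wirtingerBar_const_smul (hf.differentiableAt hw) c
  rw [wirtinger_congr hbar, wirtinger_const_smul (hf.differentiableAt_wirtingerBar hz k),
    hf.2 z hz, mul_zero]

lemma isPluriharmonic_zero (n : ℕ) : IsPluriharmonic n 0 := by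
  have hbar : ∀ k, wirtingerBar n k (0 : Cn n → ℂ) = 0 := fun k => by
    funext z
    simp [wirtingerBar]
  refine ⟨contDiffOn_const, fun z _ j k => ?_⟩
  rw [hbar]
  simp [wirtinger]

/-- The space of functions that are pluriharmonic on the unit ball. -/
def pluriharmonicSubmodule (n : ℕ) : Submodule ℂ (Cn n → ℂ) where
  carrier := {f | IsPluriharmonic n f}
  zero_mem' := isPluriharmonic_zero n
  add_mem' := IsPluriharmonic.add
  smul_mem' c _ hf := hf.const_smul c

lemma IsPluriharmonic.exists_isPeterWeyl (hf : IsPluriharmonic n f) :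
    ∃ u v, IsPeterWeyl n f u v := by
  obtain ⟨h, k, H⟩ := hf.exists_isHolAddConj
  exact ⟨_, _, H.isPeterWeyl⟩

lemma isSquaredSeminormOn_of_eq_weightedNormSq {q : (Cn n → ℂ) → ℝ≥0∞} {a : ℕ → ℝ}
    (hq : ∀ f u v, IsPluriharmonic n f → IsPeterWeyl n f u v → q f = weightedNormSq n a u v) :
    IsSquaredSeminormOn (pluriharmonicSubmodule n) q where
  smul c f hf := by
    obtain ⟨u, v, H⟩ := hf.exists_isPeterWeyl
    rw [hq _ _ _ hf H, hq _ _ _ (hf.const_smul c) (H.const_smul c), weightedNormSq_const_smul]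
  add_le f hf g hg t ht := by
    obtain ⟨u, v, H⟩ := hf.exists_isPeterWeyl
    obtain ⟨u', v', H'⟩ := hg.exists_isPeterWeyl
    rw [hq _ _ _ hf H, hq _ _ _ hg H', hq _ _ _ (hf.add hg) (H.add H')]
    exact weightedNormSq_add_le a (fun p => continuous_of_mem_solidHol (H.hol p))
      (fun p => continuous_of_mem_solidAnti (H.anti p)) ht

lemma isSquaredSeminormOn_dirichletNormSq (n : ℕ) :
    IsSquaredSeminormOn (pluriharmonicSubmodule n) (dirichletNormSq n) :=
  isSquaredSeminormOn_of_eq_weightedNormSq fun _ _ _ _ H => H.dirichletNormSq_eq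

lemma isSquaredSeminormOn_radialEnergy (hn : n ≠ 0) {m : ℕ} (hm : (n : ℝ) / 2 < m) :
    IsSquaredSeminormOn (pluriharmonicSubmodule n) (radialEnergy n m) :=
  isSquaredSeminormOn_of_eq_weightedNormSq fun _ _ _ hf H => H.radialEnergy_eq hf hn hm

lemma exists_radialEnergy_comparison (hn : n ≠ 0) {m : ℕ} (hm : (n : ℝ) / 2 < m) :
    ∃ c C : ℝ, 0 < c ∧ 0 < C ∧ ∀ f, IsPluriharmonic n f →
      ENNReal.ofReal c * dirichletNormSq n f ≤ radialEnergy n m f ∧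
      radialEnergy n m f ≤ ENNReal.ofReal C * dirichletNormSq n f := by
  have hm0 : m ≠ 0 := by
    rintro rfl
    exact hm.not_ge (by rw [Nat.cast_zero]; positivity)
  obtain ⟨c, C, hc, hC, hweight⟩ := exists_energyWeight_comparison hn hm0
  refine ⟨c, C, hc, hC, fun f hf => ?_⟩
  obtain ⟨u, v, H⟩ := hf.exists_isPeterWeyl
  rw [H.dirichletNormSq_eq, H.radialEnergy_eq hf hn hm, ← weightedNormSq_const_mul hc.le,
    ← weightedNormSq_const_mul hC.le]
  exact ⟨weightedNormSq_mono (fun p => (hweight p).1) u v,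
    weightedNormSq_mono (fun p => (hweight p).2) u v⟩

lemma mem_dirichletSpace_iff_radialEnergy_lt_top (hn : n ≠ 0) {m : ℕ} (hm : (n : ℝ) / 2 < m)
    (hf : IsPluriharmonic n f) : f ∈ dirichletSpace n ↔ radialEnergy n m f < ⊤ := by
  obtain ⟨c, C, hc, -, hcomp⟩ := exists_radialEnergy_comparison hn hm
  obtain ⟨hlower, hupper⟩ := hcomp f hf
  refine ⟨fun h => hupper.trans_lt (ENNReal.mul_lt_top ENNReal.ofReal_lt_top h.2),
    fun h => ⟨hf, ENNReal.lt_top_of_mul_ne_top_right (hlower.trans_lt h).ne ?_⟩⟩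
  exact (ENNReal.ofReal_pos.2 hc).ne'

end Dirichlet

theorem mainTheorem7 (n : ℕ) (hn : 1 ≤ n) :
    (∀ f : Cn n → ℂ, IsPluriharmonic n f →
      (f ∈ dirichletSpace n ↔ ∃ m : ℕ, (n : ℝ) / 2 < m ∧ radialEnergy n m f < ⊤) ∧
      (f ∈ dirichletSpace n ↔ ∀ m : ℕ, (n : ℝ) / 2 < m → radialEnergy n m f < ⊤)) ∧
    ∃ V : Submodule ℂ (Cn n → ℂ), (V : Set (Cn n → ℂ)) = dirichletSpace n ∧
      ∃ D : Seminorm ℂ V,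
        (∀ f : V, D f = Real.sqrt (dirichletNormSq n (f : Cn n → ℂ)).toReal) ∧
        ∀ m : ℕ, (n : ℝ) / 2 < m →
          ∃ Q : Seminorm ℂ V,
            (∀ f : V, Q f = Real.sqrt (radialEnergy n m (f : Cn n → ℂ)).toReal) ∧
            ∃ c C : ℝ, 0 < c ∧ 0 < C ∧ ∀ f : V, c * D f ≤ Q f ∧ Q f ≤ C * D f := by
  have hn0 : n ≠ 0 := Nat.one_le_iff_ne_zero.1 hn
  have hn2 : (n : ℝ) / 2 < n := half_lt_self (by exact_mod_cast hn)
  constructor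
  · intro f hf
    have hmem : ∀ {m : ℕ}, (n : ℝ) / 2 < m → (f ∈ dirichletSpace n ↔ radialEnergy n m f < ⊤) :=
      fun hm => mem_dirichletSpace_iff_radialEnergy_lt_top hn0 hm hf
    exact ⟨⟨fun h => ⟨n, hn2, (hmem hn2).1 h⟩, fun ⟨_, hm, h⟩ => (hmem hm).2 h⟩,
      ⟨fun h _ hm => (hmem hm).1 h, fun h => (hmem hn2).2 (h n hn2)⟩⟩
  have hDirichlet := isSquaredSeminormOn_dirichletNormSq n
  set V := hDirichlet.finiteSubmodule
  have hVle : V ≤ pluriharmonicSubmodule n := fun f hf => hf.1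
  obtain ⟨D, hD⟩ := hDirichlet.exists_seminorm hVle fun f hf => hf.2.ne
  refine ⟨V, rfl, D, hD, fun m hm => ?_⟩
  have hfin : ∀ f ∈ V, radialEnergy n m f ≠ ⊤ := fun f hf =>
    ((mem_dirichletSpace_iff_radialEnergy_lt_top hn0 hm hf.1).1 hf).ne
  obtain ⟨Q, hQ⟩ := (isSquaredSeminormOn_radialEnergy hn0 hm).exists_seminorm hVle hfin
  obtain ⟨c, C, hc, hC, hcomp⟩ := exists_radialEnergy_comparison hn0 hm
  refine ⟨Q, hQ, √c, √C, Real.sqrt_pos.2 hc, Real.sqrt_pos.2 hC, fun f => ?_⟩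
  rw [hD, hQ]
  exact ⟨sqrt_mul_sqrt_toReal_le hc.le (hfin f f.2) (hcomp f f.2.1).1,
    sqrt_toReal_le_sqrt_mul hC.le f.2.2.ne (hcomp f f.2.1).2⟩
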